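/- Let $P$ be a finite poset, $k$ a field, and let $R=\mathcal R_k[\mathcal I(P)]\subset k[t,x_v : v\in P]$ be the Hibi ring of $P$, i.e. the $k$-subalgebra generated by the monomials $x_I=t\prod_{v\in I}x_v$ for all poset ideals (down-closed subsets) $I\subseteq P$. Let $\mathfrak m$ be the ideal generated by all the $x_I$, so that $R/\mathfrak m=k$. Let $\omega$ be the canonical module of $R$, let $\omega^{(n)}$ be the reflexive hull of $\omega^{n}$, and let $\omega^{(-n)}=\operatorname{Hom}_R(\omega^{(n)},R)$; these modules are regarded as fractional ideals in $k(t,x_v : v\in P)$, graded by the degree in $t$. Let $\hat P=P\cup\{-\infty,\infty\}$ be $P$ with a least element $-\infty$ and a greatest element $\infty$ added, and let $\hat P_{nonmin}$ be the set of elements of $\hat P$ that lie on no shortest saturated chain $-\infty\lessdot\dots\lessdot\infty$ in $\hat P$. Suppose that $R$ is $\omega^{(-1)}$-level, i.e. that $\omega^{(-1)}$ is generated over $R$ by homogeneous elements of one and the same degree. Then the graded ring $\bigoplus_{n\ge 0}\omega^{(-n)}$ is finitely generated over $R$, and the minimal number of generators of the $R$-module $\omega^{(-n)}$ is $\Theta\big(n^{|\hat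 P_{nonmin}|}\big)$ as $n\to\infty$. Moreover, the anticanonical symbolic spread $$sp_R(\omega^{(-1)}):=\dim\Big(\bigoplus_{n\ge 0}\omega^{(-n)}\otimes_R R/\mathfrak m\Big)$$ satisfies $sp_R(\omega^{(-1)})-1=|\hat P_{nonmin}|$. -/

import Mathlib

open Filter Asymptotics
open scoped Polynomial TensorProduct

namespace HibiRing

noncomputable section

section Combinatorics

/-- `P̂`: the poset `P` with a new least element `-∞ = ⊥` and a new greatest element `∞ = ⊤`. -/
abbrev Hat (P : Type*) : Type _ := WithTop (WithBot P)

variable {P : Type*} [PartialOrder P]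

/-- `p` is an upwards path from `u` to `v`: each entry of the list is covered by the next one.
Its length is `p.length - 1`. -/
def IsUpwardPath (u v : Hat P) (p : List (Hat P)) : Prop :=
  p.IsChain (· ⋖ ·) ∧ p.head? = some u ∧ p.getLast? = some v

/-- `p` is an upwards path from `-∞` to `∞` of minimal length. -/
def IsMinimalPath (p : List (Hat P)) : Prop :=
  IsUpwardPath ⊥ ⊤ p ∧ ∀ q : List (Hat P), IsUpwardPath ⊥ ⊤ q → p.length ≤ q.length

variable (P) in
/-- The elements of `P̂` that lie on some minimal length upwards path from `-∞` to `∞`. -/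
def hatMin : Set (Hat P) := {v | ∃ p : List (Hat P), IsMinimalPath p ∧ v ∈ p}

variable (P) in
/-- The elements of `P̂` that lie on no minimal length upwards path from `-∞` to `∞`. -/
def hatNonmin : Set (Hat P) := {v | ∀ p : List (Hat P), IsMinimalPath p → v ∉ p}

end Combinatorics

section Divisorial

/-! Fractional ideals of a domain `R` inside its fraction field `K`. -/

variable {R K : Type*} [CommRing R] [Field K] [Algebra R K]

/-- The dual `(R :_K J)` of a fractional ideal `J`; for `J ≠ 0` it is identified with
`Hom_R(J, R)` by letting `f` act as multiplication by `f`. -/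
def dual (J : Submodule R K) : Submodule R K := 1 / J

/-- The symbolic power `J^(n)`, i.e. the reflexive hull of `J ^ n`. -/
def symbolicPower (J : Submodule R K) (n : ℕ) : Submodule R K := dual (dual (J ^ n))

/-- `J^(-n) = Hom_R(J^(n), R)`. -/
def negSymbolicPower (J : Submodule R K) (n : ℕ) : Submodule R K := dual (symbolicPower J n)

theorem mem_dual {J : Submodule R K} {x : K} :
    x ∈ dual J ↔ ∀ y ∈ J, x * y ∈ (1 : Submodule R K) :=
  Submodule.mem_div_iff_forall_mul_mem

theorem le_dual_dual (J : Submodule R K) : J ≤ dual (dual J) := by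
  intro x hx
  rw [mem_dual]
  intro y hy
  rw [mul_comm]
  exact mem_dual.1 hy x hx

theorem negSymbolicPower_eq (J : Submodule R K) (n : ℕ) :
    negSymbolicPower J n = dual (J ^ n) := by
  apply le_antisymm
  · intro x hx
    rw [mem_dual]
    intro y hy
    exact mem_dual.1 hx y (le_dual_dual _ hy)
  · exact le_dual_dual _

theorem mul_mem_negSymbolicPower {J : Submodule R K} {m n : ℕ} {x y : K}
    (hx : x ∈ negSymbolicPower J m) (hy : y ∈ negSymbolicPower J n) :
    x * y ∈ negSymbolicPower J (m + n) := by
  rw [negSymbolicPower_eq] at *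
  have h : dual (J ^ m) * dual (J ^ n) ≤ dual (J ^ (m + n)) := by
    unfold dual
    rw [Submodule.le_div_iff_mul_le, pow_add, mul_mul_mul_comm]
    calc _ ≤ (1 : Submodule R K) * 1 :=
          mul_le_mul' (Submodule.le_div_iff_mul_le.1 le_rfl) (Submodule.le_div_iff_mul_le.1 le_rfl)
      _ = 1 := one_mul 1
  exact h (Submodule.mul_mem_mul hx hy)

theorem algebraMap_mem_negSymbolicPower_zero (J : Submodule R K) (r : R) :
    algebraMap R K r ∈ negSymbolicPower J 0 := by
  rw [negSymbolicPower_eq, pow_zero, mem_dual]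
  intro y hy
  have h := Submodule.mul_mem_mul (Submodule.algebraMap_mem (A := K) r) hy
  rwa [one_mul] at h

/-- The graded ring `⨁_{n ≥ 0} J^(-n)`, realized as the subring of `K[T]` consisting of the
polynomials whose coefficient of `T ^ n` lies in `J^(-n)` for every `n`. -/
def negSymbolicRees (J : Submodule R K) : Subalgebra R K[X] where
  carrier := {f | ∀ n, f.coeff n ∈ negSymbolicPower J n}
  mul_mem' := by
    intro f g hf hg n
    rw [Polynomial.coeff_mul]
    refine Submodule.sum_mem _ ?_
    rintro ⟨i, j⟩ hij
    rw [← Finset.HasAntidiagonal.mem_antidiagonal.1 hij]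
    exact mul_mem_negSymbolicPower (hf i) (hg j)
  add_mem' := by
    intro f g hf hg n
    rw [Polynomial.coeff_add]
    exact Submodule.add_mem _ (hf n) (hg n)
  algebraMap_mem' := by
    intro r n
    rw [Polynomial.algebraMap_apply, Polynomial.coeff_C]
    split_ifs with h
    · subst h
      exact algebraMap_mem_negSymbolicPower_zero J r
    · exact Submodule.zero_mem _

/-- The dimension of the fiber ring `(⨁_{n ≥ 0} J^(-n)) ⊗_R R/𝔪`. -/
def negSymbolicSpread (𝔪 : Ideal R) (J : Submodule R K) : WithBot ℕ∞ :=
  ringKrullDim (negSymbolicRees J ⊗[R] (R ⧸ 𝔪))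

end Divisorial

section Canonical

/-! Let `R` be a normal domain of finite type over a field `k` whose non-smooth locus has
codimension at least two (for instance a normal affine toric ring).  Its canonical module is the
reflexive hull of the module of top differential forms `⋀^d Ω_{R/k}`, `d = dim R`.
Modulo torsion, `⋀^d Ω_{R/k}` is its image in the one-dimensional `K`-vector space
`⋀^d Ω_{K/k}`, where `K` is the fraction field of `R`.  A nonzero `η` in that space identifies
the space with `K`, and so the module with a fractional ideal. -/

variable (k R : Type*) {K : Type*} [Field k] [CommRing R] [Field K]
  [Algebra k K] [Algebra R K]

/-- The image of `⋀^d Ω_{R/k}` in `⋀^d Ω_{K/k} = K • η`: the fractional ideal generated by the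
`f` such that `f • η` is of the form `da₁ ∧ ⋯ ∧ da_d` with `a₁, …, a_d ∈ R`. -/
def topForms {d : ℕ} (η : ⋀[K]^d Ω[K⁄k]) : Submodule R K :=
  Submodule.span R {f : K | ∃ a : Fin d → R,
    f • η = exteriorPower.ιMulti K d fun i => KaehlerDifferential.D k K (algebraMap R K (a i))}

/-- The canonical module as a fractional ideal: the reflexive hull of the top forms. -/
def canonicalIdeal {d : ℕ} (η : ⋀[K]^d Ω[K⁄k]) : Submodule R K := dual (dual (topForms k R η))

end Canonical

section Hibi

variable (k P : Type*) [Field k] [PartialOrder P] [Fintype P]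

/-- The polynomial ring `k[t, x_v | v ∈ P]`; the variable `t` has the index `⊥`. -/
abbrev Poly : Type _ := MvPolynomial (WithBot P) k

/-- The field `k(t, x_v | v ∈ P)`. -/
abbrev Frac : Type _ := FractionRing (Poly k P)

open Classical in
/-- The monomial `x_I = t ∏_{v ∈ I} x_v` of a poset ideal `I`. -/
def idealMonomial (I : LowerSet P) : Poly k P :=
  MvPolynomial.X ⊥ * ∏ v : P with v ∈ I, MvPolynomial.X (v : WithBot P)

/-- The Hibi ring: the `k`-subalgebra of `k[t, x_v | v ∈ P]` generated by the `x_I`. -/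
def hibiRing : Subalgebra k (Poly k P) := Algebra.adjoin k (Set.range (idealMonomial k P))

theorem idealMonomial_mem (I : LowerSet P) : idealMonomial k P I ∈ hibiRing k P :=
  Algebra.subset_adjoin ⟨I, rfl⟩

/-- The field `k(t, x_v | v ∈ P)` is the fraction field of the Hibi ring. -/
instance isFractionRing : IsFractionRing (hibiRing k P) (Frac k P) := by
  classical
  have hinj : Function.Injective (algebraMap (hibiRing k P) (Frac k P)) :=
    (IsFractionRing.injective (Poly k P) (Frac k P)).comp Subtype.val_injective
  have hdiv : ∀ p : Poly k P, ∃ a b : hibiRing k P, (b : Poly k P) ≠ 0 ∧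
      p * b = a := by
    have hne : ∀ I : LowerSet P, idealMonomial k P I ≠ 0 := fun I =>
      mul_ne_zero (MvPolynomial.X_ne_zero _) (Finset.prod_ne_zero_iff.2 fun v _ => MvPolynomial.X_ne_zero _)
    intro p
    induction p using MvPolynomial.induction_on with
    | C c => exact ⟨algebraMap k _ c, 1, by simp, by simp [MvPolynomial.algebraMap_eq]⟩
    | add p q hp hq =>
      obtain ⟨a, b, hb, h⟩ := hp
      obtain ⟨a', b', hb', h'⟩ := hq
      refine ⟨a * b' + a' * b, b * b', by simpa using ⟨by simpa using hb, by simpa using hb'⟩, ?_⟩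
      push_cast
      rw [← h, ← h']
      ring
    | mul_X p v hp =>
      obtain ⟨a, b, hb, h⟩ := hp
      obtain ⟨c, d, hd, hX⟩ : ∃ c d : hibiRing k P, (d : Poly k P) ≠ 0 ∧
          (MvPolynomial.X v : Poly k P) * d = c := by
        induction v using WithBot.recBotCoe with
        | bot => exact ⟨⟨_, idealMonomial_mem k P ⊥⟩, 1, by simp, by simp [idealMonomial]⟩
        | coe v =>
          refine ⟨⟨_, idealMonomial_mem k P (LowerSet.Iic v)⟩,
            ⟨_, idealMonomial_mem k P (LowerSet.Iio v)⟩, hne _, ?_⟩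
          have hs : (Finset.univ.filter fun w : P => w ∈ LowerSet.Iic v) =
              insert v (Finset.univ.filter fun w : P => w ∈ LowerSet.Iio v) := by
            ext w
            simp [le_iff_eq_or_lt]
          simp only [idealMonomial]
          rw [hs, Finset.prod_insert (by simp)]
          ring
      refine ⟨a * c, b * d, by simpa using ⟨by simpa using hb, by simpa using hd⟩, ?_⟩
      push_cast
      rw [← h, ← hX]
      ring
  refine IsFractionRing.of_field _ _ fun z => ?_
  obtain ⟨p, q, hq, rfl⟩ := IsFractionRing.div_surjective (A := Poly k P) z
  obtain ⟨a, b, hb, h⟩ := hdiv p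
  obtain ⟨a', b', hb', h'⟩ := hdiv q
  have hq0 : q ≠ 0 := nonZeroDivisors.ne_zero hq
  refine ⟨a * b', a' * b, ?_⟩
  have e : ∀ r : hibiRing k P, algebraMap (hibiRing k P) (Frac k P) r =
      algebraMap (Poly k P) (Frac k P) r := fun _ => rfl
  have nz : ∀ r : Poly k P, r ≠ 0 → algebraMap (Poly k P) (Frac k P) r ≠ 0 := fun r hr => by
    simpa using hr
  simp only [e]
  push_cast
  rw [← h, ← h']
  simp only [map_mul]
  have h1 := nz _ hb
  have h2 := nz _ hb'
  have h3 := nz _ hq0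
  field_simp
/-- The homogeneous maximal ideal of the Hibi ring, generated by the `x_I`. -/
def irrelevant : Ideal (hibiRing k P) :=
  Ideal.span {r | ∃ I : LowerSet P, (r : Poly k P) = idealMonomial k P I}

/-- The variables `t` (index `⊥`) and `x_v`, as elements of the field. -/
def var (v : WithBot P) : Frac k P := algebraMap (Poly k P) (Frac k P) (MvPolynomial.X v)

/-- The Laurent monomial `x^ξ = t^{ξ(-∞)} ∏_{v ∈ P} x_v^{ξ(v)}`. -/
def laurentMonomial (ξ : WithBot P → ℤ) : Frac k P := ∏ v : WithBot P, var k P v ^ ξ v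

/-- The Laurent polynomials that are homogeneous of degree `j` in `t`. -/
def homogeneousPart (j : ℤ) : Submodule k (Frac k P) :=
  Submodule.span k (laurentMonomial k P '' {ξ | ξ ⊥ = j})

/-- The torus invariant volume form `dt/t ∧ ⋀_{v ∈ P} dx_v/x_v` (for some order of the variables,
which matters only up to a sign).  It is homogeneous of degree `0`. -/
def volumeForm : ⋀[Frac k P]^(Fintype.card (WithBot P)) Ω[Frac k P⁄k] :=
  exteriorPower.ιMulti (Frac k P) (Fintype.card (WithBot P)) fun i =>
    (var k P ((Fintype.equivFin (WithBot P)).symm i))⁻¹ •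
      KaehlerDifferential.D k (Frac k P) (var k P ((Fintype.equivFin (WithBot P)).symm i))

/-- The canonical module `ω` of the Hibi ring, as a fractional ideal; `dim R = |P| + 1`. -/
def omega : Submodule (hibiRing k P) (Frac k P) :=
  canonicalIdeal k (hibiRing k P) (volumeForm k P)

/-- `ω^(-n) = Hom_R(ω^(n), R)`. -/
def omegaNeg (n : ℕ) : Submodule (hibiRing k P) (Frac k P) := negSymbolicPower (omega k P) n

/-- The Hibi ring is `ω^(-1)`-level: `ω^(-1)` is generated over `R` by homogeneous elements of one
and the same degree. -/
def IsAnticanonicalLevel : Prop :=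
  ∃ j : ℤ, Submodule.span (hibiRing k P)
    ((omegaNeg k P 1 : Set (Frac k P)) ∩ homogeneousPart k P j) = omegaNeg k P 1

/-- The graded ring `⨁_{n ≥ 0} ω^(-n)`. -/
def anticanonicalAlgebra : Subalgebra (hibiRing k P) (Frac k P)[X] := negSymbolicRees (omega k P)

/-- The anticanonical symbolic spread `dim (⨁_{n ≥ 0} ω^(-n) ⊗_R R/𝔪)`, where `R/𝔪 = k`. -/
def symbolicSpread : WithBot ℕ∞ := negSymbolicSpread (irrelevant k P) (omega k P)

end Hibi

end

end HibiRing

/-!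
# Generators of the anticanonical symbolic powers of a level Hibi ring

Everything is expressed through the monomials `x^ξ`, for integer vectors `ξ` on `P ∪ {-∞}`, extended
by `ξ(∞) = 0`. The Hibi ring `R` is spanned by the `x^ξ` with `ξ(u) ≥ ξ(v)` for all coverings
`u ⋖ v` in `P̂` (`mem_one_iff_mem_laurentSpan`), and `ω^(-n)` by those with `ξ(u) - ξ(v) ≥ -n`
(`mem_omegaNeg_iff`); call the set of these vectors `S_n`. The second fact is a computation with
differentials: `dx^{ξ₁} ∧ ⋯ ∧ dx^{ξ_d}` is `det(ξ_j(v)) x^{ξ₁ + ⋯ + ξ_d}` times the invariant volume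
form. A nonzero determinant forces some `ξ_j` off each facet `ξ(u) = ξ(v)`, and for each facet there
is a choice with determinant `1` and exactly one `ξ_j` off it, at distance one
(`exists_laurentMonomial_mem_topForms`). The determinant `1` is what makes this work in every
characteristic.

Let `ℓ` be the length of a shortest path from `-∞` to `∞` in `P̂`. The least degree in `S_n` is
`-nℓ`; let `M_n` (`minWeights`) be the set of vectors of this degree. By rounding,
`S_{n+1} = S_1 + S_n` (`exists_add_of_mem_weights_succ`). Levelness means `S_1 = M_1 + S_0`, so
`S_n = M_n + S_0` for all `n`, and the monomials of `M_n` generate `ω^(-n)`. By their degree they do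
so minimally, which gives `|M_n|` as the number of generators (`spanFinrank_omegaNeg`), and
`⨁ ω^(-n)` is generated over `R` by the finitely many `x^ξ T` with `ξ ∈ M_1`.

A vector in `M_n` is determined on `P̂_min` by the distance `d` to `∞`, namely `ξ = -n d` there, and
on `P̂_nonmin` its values are confined to intervals of length `O(n)`. Conversely, raising `-n d` by
a multiple of `d` on `P̂_nonmin` makes all inequalities that involve `P̂_nonmin` strict, which leaves
room for `|P̂_nonmin|` independent coordinates (`perturbedWeight_mem_minWeights`). Hence
`|M_n| = Θ(n^|P̂_nonmin|)`.

Finally, the fiber `⨁ ω^(-n) ⊗ R/𝔪` is isomorphic to the algebra spanned by the monomials `x^ξ T^n`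
with `ξ ∈ M_n`, since products of monomials of least degree have least degree and all other monomials
lie in `𝔪 (⨁ ω^(-n))` (`bijective_minAlgebraToFiber`). This is an affine domain, so its dimension is
its transcendence degree. The latter is `|P̂_nonmin| + 1`: the algebra lies in the polynomial ring on
`x^(-d) T` and the `x_v` with `v ∈ P̂_nonmin` (`trdeg_minAlgebra_le`), and the leeway on `P̂_nonmin`
gives as many algebraically independent monomials (`le_trdeg_minAlgebra`).
-/

namespace HibiRing

noncomputable section

/-! ### Shortest paths in `P̂` -/

section CoverDistance

variable {P : Type*} [PartialOrder P]

theorem IsUpwardPath.append {u v w : Hat P} {p q : List (Hat P)}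
    (hp : IsUpwardPath u v p) (hq : IsUpwardPath v w q) :
    ∃ r, IsUpwardPath u w r ∧ r.length + 1 = p.length + q.length ∧ ∀ x ∈ p, x ∈ r := by
  obtain ⟨hpc, hph, hpl⟩ := hp
  obtain ⟨hqc, hqh, hql⟩ := hq
  obtain ⟨q', rfl⟩ := List.head?_eq_some_iff.1 hqh
  obtain ⟨p', rfl⟩ := List.getLast?_eq_some_iff.1 hpl
  refine ⟨p' ++ v :: q', ⟨?_, ?_, ?_⟩, ?_, ?_⟩
  · exact List.isChain_split.2 ⟨hpc, hqc⟩
  · cases p' <;> simpa using hph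
  · rw [List.getLast?_append, hql]; rfl
  · simp; omega
  · intro x hx
    simp at hx ⊢
    tauto

theorem IsUpwardPath.split {u v w : Hat P} {p : List (Hat P)} (hp : IsUpwardPath u w p)
    (hv : v ∈ p) : ∃ q r, IsUpwardPath u v q ∧ IsUpwardPath v w r ∧
      p.length + 1 = q.length + r.length := by
  obtain ⟨hpc, hph, hpl⟩ := hp
  obtain ⟨s, t, rfl⟩ := List.append_of_mem hv
  rw [List.isChain_split] at hpc
  refine ⟨s ++ [v], v :: t, ⟨hpc.1, ?_, by simp⟩, ⟨hpc.2, by simp, ?_⟩, by simp; omega⟩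
  · cases s <;> simpa using hph
  · rw [List.getLast?_append] at hpl
    cases h : (v :: t).getLast? <;> simp_all

theorem exists_isUpwardPath [Finite P] {u v : Hat P} (h : u ≤ v) : ∃ p, IsUpwardPath u v p := by
  classical
  have := Fintype.ofFinite P
  let _ : LocallyFiniteOrder (Hat P) := Fintype.toLocallyFiniteOrder
  obtain ⟨l, hl, hc, hh, hlast⟩ :=
    List.exists_isChain_ne_nil_of_relationReflTransGen (le_iff_reflTransGen_covBy.1 h)
  exact ⟨l, hc, by rw [List.head?_eq_some_head hl, hh],
    by rw [List.getLast?_eq_some_getLast hl, hlast]⟩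

/-- The number of steps of a shortest upwards path from `u` to `v` in `P̂`. It is used only for
`u ≤ v`; otherwise there is no such path, and the infimum takes the value `0`. -/
def coverDist (u v : Hat P) : ℕ := sInf {n | ∃ p, IsUpwardPath u v p ∧ p.length = n + 1}

theorem coverDist_lt {u v : Hat P} {p : List (Hat P)} (hp : IsUpwardPath u v p) :
    coverDist u v < p.length := by
  have h0 : 0 < p.length := by
    rcases p with _ | ⟨a, l⟩
    · simpa using hp.2.1
    · simp
  have : coverDist u v ≤ p.length - 1 := Nat.sInf_le ⟨p, hp, by omega⟩
  omega

theorem exists_length_eq_coverDist [Finite P] {u v : Hat P} (h : u ≤ v) :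
    ∃ p, IsUpwardPath u v p ∧ p.length = coverDist u v + 1 := by
  obtain ⟨p, hp⟩ := exists_isUpwardPath h
  have := coverDist_lt hp
  exact Nat.sInf_mem (s := {n | ∃ p, IsUpwardPath u v p ∧ p.length = n + 1})
    ⟨p.length - 1, p, hp, by omega⟩

theorem isUpwardPath_singleton (u : Hat P) : IsUpwardPath u u [u] := ⟨by simp, by simp, by simp⟩

theorem coverDist_self (u : Hat P) : coverDist u u = 0 := by
  simpa using coverDist_lt (isUpwardPath_singleton u)

theorem coverDist_triangle [Finite P] {u v w : Hat P} (huv : u ≤ v) (hvw : v ≤ w) :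
    coverDist u w ≤ coverDist u v + coverDist v w := by
  obtain ⟨p, hp, hpl⟩ := exists_length_eq_coverDist huv
  obtain ⟨q, hq, hql⟩ := exists_length_eq_coverDist hvw
  obtain ⟨r, hr, hrl, -⟩ := hp.append hq
  have := coverDist_lt hr
  omega

theorem coverDist_le_one_of_covBy {u v : Hat P} (h : u ⋖ v) : coverDist u v ≤ 1 := by
  have : IsUpwardPath u v [u, v] := ⟨by simpa using h, by simp, by simp⟩
  simpa [Nat.lt_succ_iff] using coverDist_lt this

theorem isMinimalPath_iff [Finite P] {p : List (Hat P)} :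
    IsMinimalPath p ↔ IsUpwardPath ⊥ ⊤ p ∧ p.length = coverDist (⊥ : Hat P) ⊤ + 1 := by
  constructor
  · rintro ⟨hp, hmin⟩
    obtain ⟨q, hq, hql⟩ := exists_length_eq_coverDist (bot_le : (⊥ : Hat P) ≤ ⊤)
    have := hmin q hq
    have := coverDist_lt hp
    exact ⟨hp, by omega⟩
  · rintro ⟨hp, hl⟩
    refine ⟨hp, fun q hq => ?_⟩
    have := coverDist_lt hq
    omega

theorem mem_hatMin_iff [Finite P] {v : Hat P} :
    v ∈ hatMin P ↔ coverDist ⊥ v + coverDist v ⊤ = coverDist (⊥ : Hat P) ⊤ := by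
  constructor
  · rintro ⟨p, hp, hv⟩
    rw [isMinimalPath_iff] at hp
    obtain ⟨q, r, hq, hr, hl⟩ := hp.1.split hv
    have := coverDist_lt hq
    have := coverDist_lt hr
    have := coverDist_triangle (bot_le : ⊥ ≤ v) (le_top : v ≤ ⊤)
    omega
  · intro h
    obtain ⟨p, hp, hpl⟩ := exists_length_eq_coverDist (bot_le : ⊥ ≤ v)
    obtain ⟨q, hq, hql⟩ := exists_length_eq_coverDist (le_top : v ≤ ⊤)
    obtain ⟨r, hr, hrl, hsub⟩ := hp.append hq
    refine ⟨r, isMinimalPath_iff.2 ⟨hr, by omega⟩, hsub v ?_⟩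
    exact List.mem_of_getLast? hp.2.2

theorem mem_hatNonmin_iff_notMem_hatMin {v : Hat P} : v ∈ hatNonmin P ↔ v ∉ hatMin P := by
  simp [hatNonmin, hatMin]

theorem bot_mem_hatMin [Finite P] : (⊥ : Hat P) ∈ hatMin P := by
  rw [mem_hatMin_iff, coverDist_self, zero_add]

theorem top_mem_hatMin [Finite P] : (⊤ : Hat P) ∈ hatMin P := by
  rw [mem_hatMin_iff, coverDist_self, add_zero]

theorem coverDist_top_le_of_covBy [Finite P] {u v : Hat P} (h : u ⋖ v) :
    coverDist u ⊤ ≤ coverDist v ⊤ + 1 := by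
  have := coverDist_triangle h.le (le_top : v ≤ ⊤)
  have := coverDist_le_one_of_covBy h
  omega

theorem coverDist_bot_le_of_covBy [Finite P] {u v : Hat P} (h : u ⋖ v) :
    coverDist ⊥ v ≤ coverDist ⊥ u + 1 := by
  have := coverDist_triangle (bot_le : ⊥ ≤ u) h.le
  have := coverDist_le_one_of_covBy h
  omega

/-- A step that a shortest path to `∞` can take leads from `P̂_min` only into `P̂_min`. -/
theorem mem_hatMin_of_covBy [Finite P] {u v : Hat P} (h : u ⋖ v) (hu : u ∈ hatMin P)
    (hd : coverDist u ⊤ = coverDist v ⊤ + 1) : v ∈ hatMin P := by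
  rw [mem_hatMin_iff] at *
  have := coverDist_bot_le_of_covBy h
  have := coverDist_triangle (bot_le : ⊥ ≤ v) (le_top : v ≤ ⊤)
  omega

end CoverDistance

/-! ### Exponent vectors and lattice point counts -/

section Weights

variable {P : Type*}

/-- The extension of an exponent vector `ξ` to `P̂` by the value `0` at `∞`. -/
def hatExt (ξ : WithBot P → ℤ) (v : Hat P) : ℤ := WithTop.recTopCoe 0 ξ v

@[simp] theorem hatExt_top (ξ : WithBot P → ℤ) : hatExt ξ ⊤ = 0 := rfl

@[simp] theorem hatExt_coe (ξ : WithBot P → ℤ) (v : WithBot P) : hatExt ξ (v : Hat P) = ξ v := rfl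

@[simp] theorem hatExt_bot (ξ : WithBot P → ℤ) : hatExt ξ ⊥ = ξ ⊥ := rfl

@[simp] theorem hatExt_add (ξ ζ : WithBot P → ℤ) (v : Hat P) :
    hatExt (ξ + ζ) v = hatExt ξ v + hatExt ζ v := by
  induction v using WithTop.recTopCoe <;> simp [hatExt]

@[simp] theorem hatExt_sub (ξ ζ : WithBot P → ℤ) (v : Hat P) :
    hatExt (ξ - ζ) v = hatExt ξ v - hatExt ζ v := by
  induction v using WithTop.recTopCoe <;> simp [hatExt]

@[simp] theorem hatExt_zero (v : Hat P) : hatExt (0 : WithBot P → ℤ) v = 0 := by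
  induction v using WithTop.recTopCoe <;> simp [hatExt]

theorem hatExt_restrict {f : Hat P → ℤ} (hf : f ⊤ = 0) (v : Hat P) :
    hatExt (fun w : WithBot P => f w) v = f v := by
  induction v using WithTop.recTopCoe <;> simp [hatExt, hf]

variable [PartialOrder P]

variable (P) in
/-- The exponent vectors `ξ` with `ξ(u) - ξ(v) ≥ -n` for every covering `u ⋖ v` in `P̂`. Their
monomials span `R` for `n = 0`, the canonical module for `n = -1`, and `ω^(-n)` in general. -/
def weights (n : ℤ) : Set (WithBot P → ℤ) :=
  {ξ | ∀ u v : Hat P, u ⋖ v → hatExt ξ v ≤ hatExt ξ u + n}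

theorem add_mem_weights {m n : ℤ} {ξ ζ : WithBot P → ℤ} (hξ : ξ ∈ weights P m)
    (hζ : ζ ∈ weights P n) : ξ + ζ ∈ weights P (m + n) := by
  intro u v h
  have := hξ u v h
  have := hζ u v h
  simp
  omega

theorem zero_mem_weights_zero : (0 : WithBot P → ℤ) ∈ weights P 0 := by
  intro u v _
  simp

theorem hatExt_le_of_isUpwardPath {n : ℤ} {ξ : WithBot P → ℤ} (hξ : ξ ∈ weights P n) {v : Hat P} :
    ∀ (l : List (Hat P)) (u : Hat P), IsUpwardPath u v (u :: l) →
      hatExt ξ v ≤ hatExt ξ u + n * l.length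
  | [], u, ⟨_, _, h⟩ => by
    simp at h
    simp [h]
  | w :: l, u, ⟨hc, _, h⟩ => by
    rw [List.isChain_cons_cons] at hc
    have h1 := hatExt_le_of_isUpwardPath hξ l w ⟨hc.2, by simp, by simpa using h⟩
    have h2 := hξ u w hc.1
    push_cast [List.length_cons]
    linarith

theorem hatExt_le [Finite P] {n : ℤ} {ξ : WithBot P → ℤ} (hξ : ξ ∈ weights P n) {u v : Hat P}
    (huv : u ≤ v) : hatExt ξ v ≤ hatExt ξ u + n * coverDist u v := by
  obtain ⟨p, hp, hl⟩ := exists_length_eq_coverDist huv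
  obtain ⟨l, rfl⟩ := List.head?_eq_some_iff.1 hp.2.1
  have := hatExt_le_of_isUpwardPath hξ l u hp
  simp at hl
  rwa [hl] at this

theorem antitone_hatExt [Finite P] {ξ : WithBot P → ℤ} (hξ : ξ ∈ weights P 0) :
    Antitone (hatExt ξ) := fun u v h => by
  simpa using hatExt_le hξ h

theorem nonneg_of_mem_weights_zero [Finite P] {ξ : WithBot P → ℤ} (hξ : ξ ∈ weights P 0)
    (v : WithBot P) : 0 ≤ ξ v := by
  simpa using antitone_hatExt hξ (le_top : (v : Hat P) ≤ ⊤)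

theorem eq_zero_of_mem_weights_zero [Finite P] {ξ : WithBot P → ℤ} (hξ : ξ ∈ weights P 0)
    (h : ξ ⊥ ≤ 0) : ξ = 0 := by
  funext v
  have h1 := antitone_hatExt hξ (bot_le : ⊥ ≤ (v : Hat P))
  simp at h1
  have := nonneg_of_mem_weights_zero hξ v
  simp
  omega

/-- Every element of `weights (n + 1)` is the sum of an element of `weights 1` and one of
`weights n`: `⌊ξ / (n + 1)⌋` can be split off, since `x ↦ x - ⌊x / (n + 1)⌋` is monotone. -/
theorem exists_add_of_mem_weights_succ {n : ℕ} {ξ : WithBot P → ℤ}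
    (hξ : ξ ∈ weights P (n + 1 : ℕ)) :
    ∃ ζ ∈ weights P 1, ∃ χ ∈ weights P n, ζ + χ = ξ := by
  have e : ∀ v : Hat P, hatExt (fun v => ξ v / (n + 1 : ℤ)) v = hatExt ξ v / (n + 1 : ℤ) := by
    intro v
    induction v using WithTop.recTopCoe <;> simp [hatExt]
  have hn : (0 : ℤ) < n + 1 := by positivity
  have add_div : ∀ x : ℤ, (x + (n + 1)) / (n + 1) = x / (n + 1) + 1 := fun x =>
    Int.add_ediv_of_dvd_right (dvd_refl _) |>.trans (by rw [Int.ediv_self hn.ne'])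
  have mono : ∀ x y : ℤ, x ≤ y → x - x / (n + 1) ≤ y - y / (n + 1) := by
    intro x y hxy
    obtain ⟨k, rfl⟩ := Int.le.dest hxy
    have : (x + k) / (n + 1 : ℤ) ≤ (x + k * (n + 1)) / (n + 1) :=
      Int.ediv_le_ediv hn (by nlinarith [Int.natCast_nonneg k, Int.natCast_nonneg n])
    rw [Int.add_mul_ediv_right _ _ hn.ne'] at this
    omega
  refine ⟨fun v => ξ v / (n + 1 : ℤ), fun u v h => ?_, ξ - fun v => ξ v / (n + 1 : ℤ),
    fun u v h => ?_, by simp⟩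
  · rw [e, e, ← add_div]
    refine Int.ediv_le_ediv hn ?_
    simpa using hξ u v h
  · have h1 := mono _ _ (hξ u v h)
    push_cast at h1
    rw [add_div] at h1
    rw [hatExt_sub, hatExt_sub, e, e]
    linarith

variable (P) in
/-- The elements of `weights n` of the least possible degree `-n * ℓ`, where `ℓ` is the length of
a shortest upwards path from `-∞` to `∞`. -/
def minWeights (n : ℕ) : Set (WithBot P → ℤ) :=
  {ξ | ξ ∈ weights P n ∧ ξ ⊥ = -(n : ℤ) * coverDist (⊥ : Hat P) ⊤}

theorem add_mem_minWeights {m n : ℕ} {ξ ζ : WithBot P → ℤ} (hξ : ξ ∈ minWeights P m)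
    (hζ : ζ ∈ minWeights P n) : ξ + ζ ∈ minWeights P (m + n) := by
  refine ⟨by simpa using add_mem_weights hξ.1 hζ.1, ?_⟩
  rw [Pi.add_apply, hξ.2, hζ.2]
  push_cast
  ring

section Finite

variable [Finite P]

theorem neg_coverDist_mem_weights (n : ℕ) :
    (fun v : WithBot P => -(n : ℤ) * coverDist (v : Hat P) ⊤) ∈ weights P n := by
  intro u v h
  rw [hatExt_restrict (f := fun v => -(n : ℤ) * coverDist v ⊤) (by simp [coverDist_self]),
    hatExt_restrict (f := fun v => -(n : ℤ) * coverDist v ⊤) (by simp [coverDist_self])]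
  have h1 : (coverDist u ⊤ : ℤ) ≤ coverDist v ⊤ + 1 := by exact_mod_cast coverDist_top_le_of_covBy h
  nlinarith [Int.natCast_nonneg n]

theorem neg_coverDist_le {n : ℤ} {ξ : WithBot P → ℤ} (hξ : ξ ∈ weights P n) (v : Hat P) :
    -n * coverDist v ⊤ ≤ hatExt ξ v := by
  have := hatExt_le hξ (le_top : v ≤ ⊤)
  simp at this
  linarith

theorem bot_ge_of_mem_weights {n : ℕ} {ξ : WithBot P → ℤ} (hξ : ξ ∈ weights P n) :
    -(n : ℤ) * coverDist (⊥ : Hat P) ⊤ ≤ ξ ⊥ := by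
  simpa using neg_coverDist_le hξ ⊥

theorem mem_minWeights_zero_iff {ξ : WithBot P → ℤ} : ξ ∈ minWeights P 0 ↔ ξ = 0 := by
  constructor
  · rintro ⟨h, h0⟩
    exact eq_zero_of_mem_weights_zero (by simpa using h) (by simp at h0; omega)
  · rintro rfl
    exact ⟨by simpa using zero_mem_weights_zero, by simp⟩

theorem exists_add_of_mem_minWeights_succ {n : ℕ} {ξ : WithBot P → ℤ}
    (hξ : ξ ∈ minWeights P (n + 1)) :
    ∃ ζ ∈ minWeights P 1, ∃ χ ∈ minWeights P n, ζ + χ = ξ := by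
  obtain ⟨ζ, hζ, χ, hχ, rfl⟩ := exists_add_of_mem_weights_succ hξ.1
  have h := hξ.2
  have h1 := bot_ge_of_mem_weights (n := 1) (by simpa using hζ)
  have h2 := bot_ge_of_mem_weights hχ
  rw [Pi.add_apply] at h
  push_cast at h h1
  exact ⟨ζ, ⟨by simpa using hζ, by push_cast; linarith⟩, χ, ⟨hχ, by linarith⟩, rfl⟩

/-- If the least degree generates in `weights 1`, it does so in every `weights n`. -/
theorem exists_minWeights_of_mem_weights
    (hl : ∀ ξ ∈ weights P 1, ∃ μ ∈ minWeights P 1, ξ - μ ∈ weights P 0) (n : ℕ) :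
    ∀ ξ ∈ weights P n, ∃ μ ∈ minWeights P n, ξ - μ ∈ weights P 0 := by
  induction n with
  | zero => exact fun ξ hξ => ⟨0, mem_minWeights_zero_iff.2 rfl, by simpa using hξ⟩
  | succ n ih =>
    intro ξ hξ
    obtain ⟨ζ, hζ, χ, hχ, rfl⟩ := exists_add_of_mem_weights_succ hξ
    obtain ⟨μ, hμ, hμ'⟩ := hl ζ hζ
    obtain ⟨ν, hν, hν'⟩ := ih χ hχ
    refine ⟨μ + ν, by simpa [add_comm] using add_mem_minWeights hμ hν, ?_⟩
    have := add_mem_weights hμ' hν'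
    rwa [add_zero, sub_add_sub_comm] at this

theorem hatExt_of_mem_minWeights {n : ℕ} {ξ : WithBot P → ℤ} (hξ : ξ ∈ minWeights P n) {v : Hat P}
    (hv : v ∉ hatNonmin P) : hatExt ξ v = -(n : ℤ) * coverDist v ⊤ := by
  rw [mem_hatNonmin_iff_notMem_hatMin, not_not, mem_hatMin_iff] at hv
  have h1 := hatExt_le hξ.1 (bot_le : ⊥ ≤ v)
  have h2 := neg_coverDist_le hξ.1 v
  have h3 := hξ.2
  rw [hatExt_bot, h3, ← hv] at h1
  push_cast at h1
  linarith

variable (P) in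
/-- A bound for the distances to `∞` in `P̂`. -/
def distBound : ℕ := (∑ᶠ v : Hat P, coverDist v ⊤) + 1

theorem coverDist_top_lt_distBound (v : Hat P) : coverDist v ⊤ < distBound P := by
  rw [distBound, Nat.lt_succ_iff]
  exact single_le_finsum (f := fun v : Hat P => coverDist v ⊤) v (Set.toFinite _)
    fun _ => Nat.zero_le _

/-- The vector `-n d`, where `d` is the distance to `∞`, raised by `m d + δ` on `P̂_nonmin`. Raising
it by `m d` gives every covering that involves an element of `P̂_nonmin` a slack of at least `m`,
provided that `n` is large compared with `m`; so `δ` may take arbitrary values between `0` and `m`. -/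
def perturbedWeight (n m : ℕ) (δ : Hat P → ℕ) (v : Hat P) : ℤ :=
  open Classical in
  if v ∈ hatNonmin P then -(n : ℤ) * coverDist v ⊤ + m * coverDist v ⊤ + δ v
  else -(n : ℤ) * coverDist v ⊤

theorem perturbedWeight_mem_minWeights {n m : ℕ} (hnm : m * distBound P ≤ n) {δ : Hat P → ℕ}
    (hδ : ∀ v, δ v ≤ m) : (fun v : WithBot P => perturbedWeight n m δ v) ∈ minWeights P n := by
  classical
  have htop : perturbedWeight n m δ (⊤ : Hat P) = 0 := by
    rw [perturbedWeight, if_neg]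
    · simp [coverDist_self]
    · rw [mem_hatNonmin_iff_notMem_hatMin, not_not]
      exact top_mem_hatMin
  constructor
  · intro u v h
    rw [hatExt_restrict htop, hatExt_restrict htop]
    have h1 : (coverDist u ⊤ : ℤ) ≤ coverDist v ⊤ + 1 := by
      exact_mod_cast coverDist_top_le_of_covBy h
    have hv : (coverDist v ⊤ : ℤ) + 1 ≤ distBound P := by
      exact_mod_cast coverDist_top_lt_distBound v
    have hδv : (δ v : ℤ) ≤ m := by exact_mod_cast hδ v
    have hnm' : (m * distBound P : ℤ) ≤ n := by exact_mod_cast hnm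
    have hm := Int.natCast_nonneg m
    have hmd : (m : ℤ) * (coverDist v ⊤ + 1) ≤ m * distBound P := mul_le_mul_of_nonneg_left hv hm
    have hmu : (0 : ℤ) ≤ m * coverDist u ⊤ := by positivity
    have hmv : (0 : ℤ) ≤ m * coverDist v ⊤ := by positivity
    -- if `u ⋖ v` is not tight for `-n d`, its slack is at least `n ≥ m d(v) + m`
    rcases h1.lt_or_eq with hlt | heq
    · have : (n : ℤ) * (coverDist u ⊤ + 1) ≤ n * (coverDist v ⊤ + 1) :=
        mul_le_mul_of_nonneg_left (by omega) (by positivity)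
      unfold perturbedWeight
      split_ifs <;> linarith [Int.natCast_nonneg (δ u)]
    · have hmin : v ∈ hatNonmin P → u ∈ hatNonmin P := by
        rw [mem_hatNonmin_iff_notMem_hatMin, mem_hatNonmin_iff_notMem_hatMin]
        exact mt fun hu => mem_hatMin_of_covBy h hu (by exact_mod_cast heq)
      unfold perturbedWeight
      rw [heq]
      split_ifs <;> first | (exfalso; tauto) | linarith [Int.natCast_nonneg (δ u)]
  · change perturbedWeight n m δ ⊥ = _
    rw [perturbedWeight, if_neg]
    rw [mem_hatNonmin_iff_notMem_hatMin, not_not]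
    exact bot_mem_hatMin

theorem minWeights_injOn (n : ℕ) :
    Set.InjOn (fun (ξ : WithBot P → ℤ) (v : hatNonmin P) => hatExt ξ v) (minWeights P n) := by
  intro ξ hξ ζ hζ h
  have key : ∀ v : Hat P, hatExt ξ v = hatExt ζ v := by
    intro v
    by_cases hv : v ∈ hatNonmin P
    · exact congrFun h ⟨v, hv⟩
    · rw [hatExt_of_mem_minWeights hξ hv, hatExt_of_mem_minWeights hζ hv]
  funext v
  simpa using key v

theorem finite_minWeights_and_ncard_le (n : ℕ) : (minWeights P n).Finite ∧
    (minWeights P n).ncard ≤ (n * ∑ᶠ v : Hat P, coverDist ⊥ v + n * distBound P + 1) ^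
      (hatNonmin P).ncard := by
  classical
  have := Fintype.ofFinite P
  have := Fintype.ofFinite (hatNonmin P)
  set s : Finset (hatNonmin P → ℤ) := Fintype.piFinset fun v : hatNonmin P =>
    Finset.Icc (-(n : ℤ) * coverDist (v : Hat P) ⊤) (n * coverDist ⊥ (v : Hat P)) with hs
  have hmaps : Set.MapsTo (fun (ξ : WithBot P → ℤ) (v : hatNonmin P) => hatExt ξ v)
      (minWeights P n) s := by
    intro ξ hξ
    rw [hs, Finset.mem_coe, Fintype.mem_piFinset]
    intro v
    rw [Finset.mem_Icc]
    refine ⟨neg_coverDist_le hξ.1 v, ?_⟩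
    have h1 := hatExt_le hξ.1 (bot_le : ⊥ ≤ (v : Hat P))
    have h2 : ξ ⊥ ≤ 0 := by
      rw [hξ.2, neg_mul, neg_nonpos]
      positivity
    rw [hatExt_bot] at h1
    linarith
  have hfin : (minWeights P n).Finite :=
    Set.Finite.of_injOn hmaps (minWeights_injOn n) s.finite_toSet
  refine ⟨hfin, ?_⟩
  calc (minWeights P n).ncard ≤ (s : Set (hatNonmin P → ℤ)).ncard :=
        Set.ncard_le_ncard_of_injOn _ (fun ξ hξ => hmaps hξ) (minWeights_injOn n) s.finite_toSet
    _ = ∏ v : hatNonmin P, (Finset.Icc (-(n : ℤ) * coverDist (v : Hat P) ⊤)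
          (n * coverDist ⊥ (v : Hat P))).card := by
        rw [Set.ncard_coe_finset, hs, Fintype.card_piFinset]
    _ ≤ ∏ v : hatNonmin P, (n * ∑ᶠ v : Hat P, coverDist ⊥ v + n * distBound P + 1) := by
        refine Finset.prod_le_prod' fun v _ => ?_
        rw [Int.card_Icc]
        have h1 : n * coverDist ⊥ (v : Hat P) ≤ n * ∑ᶠ v : Hat P, coverDist ⊥ v :=
          Nat.mul_le_mul_left _ <|
            single_le_finsum (f := fun v : Hat P => coverDist ⊥ v) (v : Hat P) (Set.toFinite _)
              fun _ => Nat.zero_le _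
        have h2 : n * coverDist (v : Hat P) ⊤ ≤ n * distBound P :=
          Nat.mul_le_mul_left _ (coverDist_top_lt_distBound _).le
        zify at h1 h2
        rw [Int.toNat_le]
        push_cast
        linarith
    _ = _ := by
        rw [Finset.prod_const, Finset.card_univ, ← Nat.card_eq_fintype_card,
          Nat.card_coe_set_eq]

theorem pow_le_ncard_minWeights (n : ℕ) :
    (n / distBound P + 1) ^ (hatNonmin P).ncard ≤ (minWeights P n).ncard := by
  classical
  have := Fintype.ofFinite (hatNonmin P)
  set m := n / distBound P with hm
  let F : (hatNonmin P → Fin (m + 1)) → (WithBot P → ℤ) := fun δ v =>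
    perturbedWeight n m (fun w => if h : w ∈ hatNonmin P then δ ⟨w, h⟩ else 0) (v : Hat P)
  have hF : ∀ δ, F δ ∈ minWeights P n := fun δ => by
    refine perturbedWeight_mem_minWeights (Nat.div_mul_le_self _ _) fun v => ?_
    split_ifs
    · exact Nat.lt_succ_iff.1 (δ _).2
    · exact Nat.zero_le _
  have hinj : Function.Injective F := by
    intro δ ε h
    funext ⟨v, hv⟩
    obtain ⟨w, rfl⟩ : ∃ w : WithBot P, (w : Hat P) = v := by
      rw [← WithTop.ne_top_iff_exists]
      rintro rfl
      exact mem_hatNonmin_iff_notMem_hatMin.1 hv top_mem_hatMin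
    have := congrFun h w
    simp only [F, perturbedWeight, if_pos hv, dif_pos hv] at this
    ext
    simpa using this
  calc (m + 1) ^ (hatNonmin P).ncard = (Set.univ : Set (hatNonmin P → Fin (m + 1))).ncard := by
        rw [Set.ncard_univ, Nat.card_eq_fintype_card, Fintype.card_fun, Fintype.card_fin,
          ← Nat.card_eq_fintype_card, Nat.card_coe_set_eq]
    _ ≤ _ := Set.ncard_le_ncard_of_injOn F (fun δ _ => hF δ) hinj.injOn
        (finite_minWeights_and_ncard_le n).1

theorem ncard_minWeights_isTheta :
    (fun n : ℕ => ((minWeights P n).ncard : ℝ)) =Θ[atTop]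
      fun n : ℕ => (n : ℝ) ^ (hatNonmin P).ncard := by
  set q := (hatNonmin P).ncard
  constructor
  · set C := (∑ᶠ v : Hat P, coverDist ⊥ v) + distBound P + 1 with hC
    refine IsBigO.of_bound ((C : ℝ) ^ q) ?_
    filter_upwards [eventually_ge_atTop 1] with n hn
    rw [Real.norm_of_nonneg (by positivity), Real.norm_of_nonneg (by positivity), ← mul_pow]
    refine le_trans (Nat.cast_le.2 (finite_minWeights_and_ncard_le n).2) ?_
    rw [Nat.cast_pow]
    refine pow_le_pow_left₀ (by positivity) ?_ _
    rw [← Nat.cast_mul, Nat.cast_le, hC]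
    nlinarith
  · refine IsBigO.of_bound ((distBound P : ℝ) ^ q) (Eventually.of_forall fun n => ?_)
    rw [Real.norm_of_nonneg (by positivity), Real.norm_of_nonneg (by positivity)]
    refine le_trans ?_ (mul_le_mul_of_nonneg_left (Nat.cast_le.2 (pow_le_ncard_minWeights n))
      (by positivity))
    rw [Nat.cast_pow, ← mul_pow]
    refine pow_le_pow_left₀ (by positivity) ?_ _
    rw [← Nat.cast_mul, Nat.cast_le]
    exact (Nat.lt_mul_div_succ n (Nat.succ_pos _)).le

end Finite

end Weights

/-! ### Laurent monomials and the Hibi ring -/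

section LaurentMonomials

variable (k P : Type*) [Field k]

theorem var_ne_zero (v : WithBot P) : var k P v ≠ 0 := by
  simp [var, MvPolynomial.X_ne_zero]

variable [Fintype P]

theorem laurentMonomial_zero : laurentMonomial k P 0 = 1 := by
  simp [laurentMonomial]

theorem laurentMonomial_add (ξ ζ : WithBot P → ℤ) :
    laurentMonomial k P (ξ + ζ) = laurentMonomial k P ξ * laurentMonomial k P ζ := by
  simp [laurentMonomial, zpow_add₀ (var_ne_zero k P _), Finset.prod_mul_distrib]

theorem laurentMonomial_nsmul (n : ℕ) (ξ : WithBot P → ℤ) :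
    laurentMonomial k P (n • ξ) = laurentMonomial k P ξ ^ n := by
  induction n with
  | zero => simp [laurentMonomial_zero]
  | succ n ih => rw [succ_nsmul, laurentMonomial_add, ih, pow_succ]

theorem laurentMonomial_sum {ι : Type*} (s : Finset ι) (ξ : ι → WithBot P → ℤ) :
    laurentMonomial k P (∑ i ∈ s, ξ i) = ∏ i ∈ s, laurentMonomial k P (ξ i) := by
  classical
  induction s using Finset.induction_on with
  | empty => simp [laurentMonomial_zero]
  | insert a s ha ih => rw [Finset.sum_insert ha, Finset.prod_insert ha, laurentMonomial_add, ih]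

theorem laurentMonomial_of_nonneg {ξ : WithBot P → ℤ} (hξ : ∀ v, 0 ≤ ξ v) :
    laurentMonomial k P ξ = algebraMap (Poly k P) (Frac k P)
      (MvPolynomial.monomial (Finsupp.equivFunOnFinite.symm fun v => (ξ v).toNat) 1) := by
  rw [laurentMonomial, MvPolynomial.monomial_eq, map_one, one_mul,
    Finsupp.prod_fintype _ _ (fun _ => pow_zero _), map_prod]
  refine Finset.prod_congr rfl fun v _ => ?_
  rw [map_pow, Finsupp.coe_equivFunOnFinite_symm, var, ← zpow_natCast, Int.toNat_of_nonneg (hξ v)]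

theorem linearIndependent_laurentMonomial : LinearIndependent k (laurentMonomial k P) := by
  rw [linearIndependent_iff_finset_linearIndependent]
  intro s
  -- multiplication by the monomial of `N` turns the monomials in `s` into ordinary monomials
  let N : WithBot P → ℤ := fun v => ∑ ξ ∈ s, |ξ v|
  have hN : ∀ ξ ∈ s, ∀ v, 0 ≤ (N + ξ) v := fun ξ hξ v => by
    have h1 : |ξ v| ≤ N v := Finset.single_le_sum (f := fun ξ : WithBot P → ℤ => |ξ v|)
      (fun ξ _ => abs_nonneg _) hξ
    have := neg_abs_le (ξ v)
    rw [Pi.add_apply]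
    linarith
  refine LinearIndependent.of_comp (LinearMap.mulLeft k (laurentMonomial k P N)) ?_
  have e : (LinearMap.mulLeft k (laurentMonomial k P N)) ∘ (laurentMonomial k P ∘ Subtype.val) =
      ((IsScalarTower.toAlgHom k (Poly k P) (Frac k P)).toLinearMap ∘
        MvPolynomial.basisMonomials (WithBot P) k) ∘
        fun ξ : s => Finsupp.equivFunOnFinite.symm fun v => ((N + ξ : WithBot P → ℤ) v).toNat := by
    funext ξ
    simp only [Function.comp_apply, LinearMap.mulLeft_apply, ← laurentMonomial_add,
      MvPolynomial.coe_basisMonomials]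
    exact laurentMonomial_of_nonneg k P (hN ξ ξ.2)
  rw [e]
  refine LinearIndependent.comp ?_ _ ?_
  · refine (MvPolynomial.basisMonomials (WithBot P) k).linearIndependent.map' _
      (LinearMap.ker_eq_bot.2 ?_)
    exact IsFractionRing.injective (Poly k P) (Frac k P)
  · intro ξ ζ h
    ext v
    have h1 := congrFun (Finsupp.equivFunOnFinite.symm.injective h) v
    have h2 := hN ξ ξ.2 v
    have h3 := hN ζ ζ.2 v
    simp only [Pi.add_apply] at h1 h2 h3
    omega

/-- The Laurent polynomials in `k(t, x_v | v ∈ P)` whose exponent vectors lie in `A`. -/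
def laurentSpan (A : Set (WithBot P → ℤ)) : Submodule k (Frac k P) :=
  Submodule.span k (laurentMonomial k P '' A)

variable {k P}

theorem laurentMonomial_mem_laurentSpan {A : Set (WithBot P → ℤ)} {ξ : WithBot P → ℤ} :
    laurentMonomial k P ξ ∈ laurentSpan k P A ↔ ξ ∈ A := by
  refine ⟨fun h => ?_, fun h => Submodule.subset_span ⟨ξ, h, rfl⟩⟩
  by_contra hξ
  exact (linearIndependent_laurentMonomial k P).notMem_span_image hξ h

theorem laurentSpan_mono {A B : Set (WithBot P → ℤ)} (h : A ⊆ B) :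
    laurentSpan k P A ≤ laurentSpan k P B :=
  Submodule.span_mono (Set.image_mono h)

theorem mem_laurentSpan_iInter {ι : Type*} [Nonempty ι] {A : ι → Set (WithBot P → ℤ)}
    {x : Frac k P} : x ∈ laurentSpan k P (⋂ i, A i) ↔ ∀ i, x ∈ laurentSpan k P (A i) := by
  simp only [laurentSpan, Finsupp.span_image_eq_map_linearCombination]
  rw [← Submodule.mem_iInf, Finsupp.supported_iInter,
    Submodule.map_iInf _ (linearIndependent_laurentMonomial k P)]

theorem laurentSpan_inter (A B : Set (WithBot P → ℤ)) :
    laurentSpan k P (A ∩ B) = laurentSpan k P A ⊓ laurentSpan k P B := by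
  simp only [laurentSpan, Finsupp.span_image_eq_map_linearCombination]
  rw [Finsupp.supported_inter,
    Submodule.map_inf _ (linearIndependent_laurentMonomial k P)]

theorem mul_mem_laurentSpan {A B C : Set (WithBot P → ℤ)} {x y : Frac k P}
    (hx : x ∈ laurentSpan k P A) (hy : y ∈ laurentSpan k P B)
    (h : ∀ ξ ∈ A, ∀ ζ ∈ B, ξ + ζ ∈ C) : x * y ∈ laurentSpan k P C := by
  have h1 : laurentSpan k P A * laurentSpan k P B ≤ laurentSpan k P C := by
    rw [laurentSpan, laurentSpan, Submodule.span_mul_span, Submodule.span_le]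
    rintro _ ⟨_, ⟨ξ, hξ, rfl⟩, _, ⟨ζ, hζ, rfl⟩, rfl⟩
    change laurentMonomial k P ξ * laurentMonomial k P ζ ∈ _
    rw [← laurentMonomial_add]
    exact laurentMonomial_mem_laurentSpan.2 (h ξ hξ ζ hζ)
  exact h1 (Submodule.mul_mem_mul hx hy)

theorem mul_laurentMonomial_mem_laurentSpan {A : Set (WithBot P → ℤ)} {x : Frac k P}
    {ζ : WithBot P → ℤ} :
    x * laurentMonomial k P ζ ∈ laurentSpan k P A ↔ x ∈ laurentSpan k P {ξ | ξ + ζ ∈ A} := by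
  constructor
  · intro h
    have h1 := mul_mem_laurentSpan (B := {-ζ}) (C := {ξ | ξ + ζ ∈ A}) h
      (laurentMonomial_mem_laurentSpan.2 rfl) (by rintro ξ hξ _ rfl; simpa using hξ)
    rwa [mul_assoc, ← laurentMonomial_add, add_neg_cancel, laurentMonomial_zero, mul_one] at h1
  · intro h
    exact mul_mem_laurentSpan (B := {ζ}) h (laurentMonomial_mem_laurentSpan.2 rfl)
      (by rintro ξ hξ _ rfl; exact hξ)

end LaurentMonomials

section Coordinate

theorem prod_withBot {P M : Type*} [Fintype P] [CommMonoid M] (f : WithBot P → M) :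
    ∏ v, f v = f ⊥ * ∏ v : P, f v :=
  Fintype.prod_option f

variable (k P : Type*) [Field k] [PartialOrder P]

open Classical in
/-- The exponent vector of the generator `x_I` of the Hibi ring. -/
def idealWeight (I : LowerSet P) : WithBot P → ℤ :=
  WithBot.recBotCoe 1 fun v => if v ∈ I then 1 else 0

variable {P}

@[simp] theorem idealWeight_bot (I : LowerSet P) : idealWeight P I ⊥ = 1 := rfl

open Classical in
@[simp] theorem idealWeight_coe (I : LowerSet P) (v : P) :
    idealWeight P I v = if v ∈ I then 1 else 0 := rfl

variable [Fintype P]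

theorem mem_weights_zero_iff {ξ : WithBot P → ℤ} :
    ξ ∈ weights P 0 ↔ Antitone ξ ∧ ∀ v, 0 ≤ ξ v := by
  refine ⟨fun h => ⟨fun u v huv => ?_, nonneg_of_mem_weights_zero h⟩, fun h u v huv => ?_⟩
  · exact antitone_hatExt h (WithTop.coe_le_coe.2 huv)
  · rw [add_zero]
    have huv := huv.le
    induction v using WithTop.recTopCoe with
    | top => induction u using WithTop.recTopCoe <;> simp [h.2]
    | coe v =>
      induction u using WithTop.recTopCoe with
      | top => simp at huv
      | coe u => exact h.1 (WithTop.coe_le_coe.1 huv)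

theorem idealWeight_mem_weights_zero (I : LowerSet P) : idealWeight P I ∈ weights P 0 := by
  rw [mem_weights_zero_iff]
  constructor
  · intro u v huv
    induction v using WithBot.recBotCoe with
    | bot => rw [le_bot_iff.1 huv]
    | coe v =>
      induction u using WithBot.recBotCoe with
      | bot =>
        rw [idealWeight_bot, idealWeight_coe]
        split_ifs <;> simp
      | coe u =>
        rw [idealWeight_coe, idealWeight_coe]
        have : v ∈ I → u ∈ I := I.lower (WithBot.coe_le_coe.1 huv)
        split_ifs <;> tauto
  · intro v
    induction v using WithBot.recBotCoe with
    | bot => simp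
    | coe v =>
      rw [idealWeight_coe]
      split_ifs <;> simp

theorem algebraMap_idealMonomial (I : LowerSet P) :
    algebraMap (Poly k P) (Frac k P) (idealMonomial k P I) =
      laurentMonomial k P (idealWeight P I) := by
  classical
  rw [laurentMonomial, prod_withBot, idealMonomial, map_mul, map_prod, Finset.prod_filter]
  congr 1
  · simp [var]
  · refine Finset.prod_congr rfl fun v _ => ?_
    rw [idealWeight_coe]
    split_ifs <;> simp [var]

/-- The support in `P` of an exponent vector `ξ` in the cone of the Hibi ring is a poset ideal, and
its indicator can be subtracted from `ξ`. -/
theorem exists_sub_idealWeight_mem_weights_zero {ξ : WithBot P → ℤ} (hξ : ξ ∈ weights P 0)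
    (h : 1 ≤ ξ ⊥) : ∃ I : LowerSet P, ξ - idealWeight P I ∈ weights P 0 := by
  rw [mem_weights_zero_iff] at hξ
  let I : LowerSet P := ⟨{v | 1 ≤ ξ v}, fun v u huv hv =>
    le_trans (b := ξ v) hv (hξ.1 (WithBot.coe_le_coe.2 huv))⟩
  have hI : ∀ v : WithBot P, idealWeight P I v = if 1 ≤ ξ v then 1 else 0 := by
    intro v
    induction v using WithBot.recBotCoe with
    | bot => rw [idealWeight_bot, if_pos h]
    | coe v =>
      rw [idealWeight_coe]
      exact ite_congr rfl (fun _ => rfl) fun _ => rfl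
  refine ⟨I, mem_weights_zero_iff.2 ⟨fun u v huv => ?_, fun v => ?_⟩⟩
  · have := hξ.1 huv
    have := hξ.2 v
    simp only [Pi.sub_apply, hI]
    split_ifs <;> omega
  · have := hξ.2 v
    simp only [Pi.sub_apply, hI]
    split_ifs <;> omega

theorem laurentMonomial_mem_one_of_mem_weights_zero :
    ∀ (n : ℕ) (ξ : WithBot P → ℤ), ξ ∈ weights P 0 → ξ ⊥ = n →
      laurentMonomial k P ξ ∈ (1 : Submodule (hibiRing k P) (Frac k P))
  | 0, ξ, hξ, h => by
    rw [eq_zero_of_mem_weights_zero hξ (by simp [h]), laurentMonomial_zero]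
    exact Submodule.one_le.1 le_rfl
  | n + 1, ξ, hξ, h => by
    obtain ⟨I, h1⟩ := exists_sub_idealWeight_mem_weights_zero hξ (by push_cast at h; omega)
    have h2 := laurentMonomial_mem_one_of_mem_weights_zero n _ h1 (by simp [h])
    have h3 : laurentMonomial k P (idealWeight P I) ∈
        (1 : Submodule (hibiRing k P) (Frac k P)) := by
      rw [Submodule.mem_one]
      exact ⟨⟨_, idealMonomial_mem k P I⟩, algebraMap_idealMonomial k I⟩
    have h4 := Submodule.mul_mem_mul h2 h3
    rwa [mul_one (1 : Submodule (hibiRing k P) (Frac k P)), ← laurentMonomial_add,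
      sub_add_cancel] at h4

variable {k}

theorem smul_eq_algebraMap_mul (c : k) (r : hibiRing k P) :
    algebraMap (hibiRing k P) (Frac k P) (c • r) = c • algebraMap (hibiRing k P) (Frac k P) r := by
  change algebraMap (Poly k P) (Frac k P) (c • (r : Poly k P)) = _
  rw [Algebra.smul_def, map_mul, Algebra.smul_def c, IsScalarTower.algebraMap_apply k (Poly k P)]
  rfl

theorem algebraMap_mem_laurentSpan (r : hibiRing k P) :
    algebraMap (hibiRing k P) (Frac k P) r ∈ laurentSpan k P (weights P 0) := by
  obtain ⟨r, hr⟩ := r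
  change algebraMap (Poly k P) (Frac k P) r ∈ _
  have one_mem : (1 : Frac k P) ∈ laurentSpan k P (weights P 0) := by
    rw [← laurentMonomial_zero]
    exact laurentMonomial_mem_laurentSpan.2 zero_mem_weights_zero
  induction hr using Algebra.adjoin_induction with
  | mem x hx =>
    obtain ⟨I, rfl⟩ := hx
    rw [algebraMap_idealMonomial]
    exact laurentMonomial_mem_laurentSpan.2 (idealWeight_mem_weights_zero I)
  | algebraMap c =>
    rw [← IsScalarTower.algebraMap_apply, Algebra.algebraMap_eq_smul_one]
    exact Submodule.smul_mem _ _ one_mem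
  | add x y _ _ hx hy => rw [map_add]; exact Submodule.add_mem _ hx hy
  | mul x y _ _ hx hy =>
    rw [map_mul]
    exact mul_mem_laurentSpan hx hy fun ξ hξ ζ hζ => by simpa using add_mem_weights hξ hζ

/-- The Hibi ring is the span of the monomials whose exponent vectors are nonnegative and
order-reversing. -/
theorem mem_one_iff_mem_laurentSpan {x : Frac k P} :
    x ∈ (1 : Submodule (hibiRing k P) (Frac k P)) ↔ x ∈ laurentSpan k P (weights P 0) := by
  constructor
  · rw [Submodule.mem_one]
    rintro ⟨r, rfl⟩
    exact algebraMap_mem_laurentSpan r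
  · intro hx
    induction hx using Submodule.span_induction with
    | mem x hx =>
      obtain ⟨ξ, hξ, rfl⟩ := hx
      obtain ⟨n, hn⟩ := Int.eq_ofNat_of_zero_le (nonneg_of_mem_weights_zero hξ ⊥)
      exact laurentMonomial_mem_one_of_mem_weights_zero k n ξ hξ hn
    | zero => exact Submodule.zero_mem _
    | add x y _ _ hx hy => exact Submodule.add_mem _ hx hy
    | smul c x _ hx =>
      rw [Submodule.mem_one] at hx ⊢
      obtain ⟨r, rfl⟩ := hx
      exact ⟨c • r, smul_eq_algebraMap_mul c r⟩

theorem smul_mem_laurentSpan {A : Set (WithBot P → ℤ)} {B : Set (WithBot P → ℤ)} {x : Frac k P}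
    (hx : x ∈ laurentSpan k P A) (r : hibiRing k P)
    (h : ∀ ξ ∈ weights P 0, ∀ ζ ∈ A, ξ + ζ ∈ B) : r • x ∈ laurentSpan k P B := by
  rw [Algebra.smul_def]
  exact mul_mem_laurentSpan (algebraMap_mem_laurentSpan r) hx h

theorem exists_algebraMap_eq_laurentMonomial {ξ : WithBot P → ℤ} (hξ : ξ ∈ weights P 0) :
    ∃ r : hibiRing k P, algebraMap (hibiRing k P) (Frac k P) r = laurentMonomial k P ξ :=
  Submodule.mem_one.1 (mem_one_iff_mem_laurentSpan.2 (laurentMonomial_mem_laurentSpan.2 hξ))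

end Coordinate

/-! ### Top differential forms of the Hibi ring -/

section Multilinear

theorem alternatingMap_eq_det_smul {R M N ι : Type*} [CommRing R] [AddCommGroup M] [Module R M]
    [AddCommGroup N] [Module R N] [Fintype ι] [DecidableEq ι] (e : Module.Basis ι R M)
    (f : M [⋀^ι]→ₗ[R] N) (v : ι → M) : f v = e.det v • f e := by
  have h : f = (LinearMap.toSpanSingleton R N (f e)).compAlternatingMap e.det := by
    refine Module.Basis.ext_alternating e fun i hi => ?_
    let σ : Equiv.Perm ι := Equiv.ofBijective i (Finite.injective_iff_bijective.1 hi)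
    change f (e ∘ σ) = e.det (e ∘ σ) • f e
    simp [AlternatingMap.map_perm, Module.Basis.det_self]
  exact congrArg (fun g => g v) h

/-- To show that a multilinear map has values in a submodule, one may test it on generators. -/
theorem multilinearMap_mem_of_mem_span {R V W ι : Type*} [CommRing R] [AddCommGroup V] [Module R V]
    [AddCommGroup W] [Module R W] [Finite ι] (g : MultilinearMap R (fun _ : ι => V) W)
    (N : Submodule R W) (S : Set V) (hS : ∀ a : ι → V, (∀ i, a i ∈ S) → g a ∈ N)
    (a : ι → V) (ha : ∀ i, a i ∈ Submodule.span R S) : g a ∈ N := by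
  classical
  have := Fintype.ofFinite ι
  have key : ∀ (s : Finset ι) (a : ι → V), (∀ i ∈ s, a i ∈ Submodule.span R S) →
      (∀ i ∉ s, a i ∈ S) → g a ∈ N := by
    intro s
    induction s using Finset.induction_on with
    | empty => exact fun a _ h => hS a fun i => h i (by simp)
    | insert j s hj ih =>
      intro a h1 h2
      have upd : ∀ x ∈ Submodule.span R S, g (Function.update a j x) ∈ N := by
        intro x hx
        induction hx using Submodule.span_induction with
        | mem x hx =>
          refine ih _ (fun i hi => ?_) fun i hi => ?_
          · rw [Function.update_of_ne (by rintro rfl; exact hj hi)]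
            exact h1 i (Finset.mem_insert_of_mem hi)
          · rcases eq_or_ne i j with rfl | hij
            · rwa [Function.update_self]
            · rw [Function.update_of_ne hij]
              exact h2 i (by simp [hij, hi])
        | zero => rw [g.map_update_zero]; exact N.zero_mem
        | add x y _ _ hx hy => rw [g.map_update_add]; exact N.add_mem hx hy
        | smul c x _ hx => rw [g.map_update_smul]; exact N.smul_mem c hx
      simpa using upd (a j) (h1 j (Finset.mem_insert_self _ _))
  exact key Finset.univ a (fun i _ => ha i) (by simp)

/-- The determinant of an integer matrix that is unitriangular for some ordering of its index set,
given by a weight function `b`. -/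
theorem det_eq_one_of_weight {n : Type*} [Fintype n] [DecidableEq n] {M : Matrix n n ℤ} (b : n → ℕ)
    (hdiag : ∀ i, M i i = 1) (hlt : ∀ i j, i ≠ j → M i j ≠ 0 → b i < b j) : M.det = 1 := by
  rw [Matrix.det_apply, Finset.sum_eq_single 1]
  · simp [hdiag]
  · intro σ _ hσ
    rw [Finset.prod_eq_zero_iff.2, smul_zero]
    by_contra! h
    obtain ⟨i, hi⟩ : ∃ i, σ i ≠ i := by
      by_contra! h'
      exact hσ (Equiv.ext h')
    have h1 : ∑ i, b (σ i) < ∑ i, b i := by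
      refine Finset.sum_lt_sum (fun i _ => ?_) ⟨i, Finset.mem_univ _, hlt _ _ hi (h i (by simp))⟩
      by_cases hi : σ i = i
      · rw [hi]
      · exact (hlt _ _ hi (h i (by simp))).le
    rw [Equiv.sum_comp σ b] at h1
    exact lt_irrefl _ h1
  · simp

end Multilinear

section Differentials

variable (k P : Type*) [Field k] [Fintype P]

/-- The basis of `Ω[K⁄k]` that consists of the logarithmic differentials `dx / x` of the variables,
in the order that `volumeForm` uses. -/
def logBasis : Module.Basis (Fin (Fintype.card (WithBot P))) (Frac k P) Ω[Frac k P⁄k] :=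
  (((KaehlerDifferential.mvPolynomialBasis k (WithBot P)).ofIsLocalizedModule (Frac k P)
    (nonZeroDivisors (Poly k P)) (KaehlerDifferential.map k k (Poly k P) (Frac k P))).unitsSMul
      fun v => (Units.mk0 (var k P v) (var_ne_zero k P v))⁻¹).reindex
    (Fintype.equivFin (WithBot P))

theorem logBasis_apply (i : Fin (Fintype.card (WithBot P))) :
    logBasis k P i = (var k P ((Fintype.equivFin (WithBot P)).symm i))⁻¹ •
      KaehlerDifferential.D k (Frac k P) (var k P ((Fintype.equivFin (WithBot P)).symm i)) := by
  rw [logBasis, Module.Basis.reindex_apply, Module.Basis.unitsSMul_apply,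
    Module.Basis.ofIsLocalizedModule_apply, KaehlerDifferential.mvPolynomialBasis_apply,
    KaehlerDifferential.map_D, Units.smul_def, Units.val_inv_eq_inv_val, Units.val_mk0]
  rfl

theorem volumeForm_eq : volumeForm k P = exteriorPower.ιMulti (Frac k P) _ (logBasis k P) := by
  rw [volumeForm]
  congr 1
  funext i
  rw [logBasis_apply]

theorem volumeForm_ne_zero : volumeForm k P ≠ 0 := by
  rw [volumeForm_eq]
  intro h
  have h1 := exteriorPower.alternatingMapLinearEquiv_apply_ιMulti (logBasis k P).det (logBasis k P)
  rw [h, map_zero, Module.Basis.det_self] at h1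
  exact zero_ne_one h1

theorem D_laurentMonomial (ξ : WithBot P → ℤ) :
    KaehlerDifferential.D k (Frac k P) (laurentMonomial k P ξ) =
      ∑ i, (laurentMonomial k P ξ * ξ ((Fintype.equivFin (WithBot P)).symm i)) •
        logBasis k P i := by
  have key : ∀ s : Finset (WithBot P),
      KaehlerDifferential.D k (Frac k P) (∏ v ∈ s, var k P v ^ ξ v) =
      ∑ v ∈ s, ((∏ v ∈ s, var k P v ^ ξ v) * ξ v) • (var k P v)⁻¹ •
        KaehlerDifferential.D k (Frac k P) (var k P v) := by
    classical
    intro s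
    induction s using Finset.induction_on with
    | empty => simp
    | insert a s ha ih =>
      rw [Finset.prod_insert ha, Derivation.leibniz, ih, Finset.sum_insert ha,
        Derivation.leibniz_zpow, Finset.smul_sum, add_comm]
      congr 1
      · rw [← Int.cast_smul_eq_zsmul (Frac k P), smul_smul, smul_smul, smul_smul,
          zpow_sub_one₀ (var_ne_zero k P a)]
        congr 1
        ring
      · refine Finset.sum_congr rfl fun v _ => ?_
        rw [smul_smul (var k P a ^ ξ a)]
        congr 1
        ring
  rw [laurentMonomial, key, ← Equiv.sum_comp (Fintype.equivFin (WithBot P)).symm]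
  refine Finset.sum_congr rfl fun i _ => ?_
  rw [logBasis_apply]

theorem logBasis_det_laurentMonomial
    (ξ : Fin (Fintype.card (WithBot P)) → WithBot P → ℤ) :
    (logBasis k P).det (fun j => KaehlerDifferential.D k (Frac k P) (laurentMonomial k P (ξ j))) =
      (Matrix.of fun i j => ξ j ((Fintype.equivFin (WithBot P)).symm i)).det *
        laurentMonomial k P (∑ j, ξ j) := by
  have h : (logBasis k P).toMatrix
      (fun j => KaehlerDifferential.D k (Frac k P) (laurentMonomial k P (ξ j))) =
      Matrix.of fun i j => laurentMonomial k P (ξ j) *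
        (Matrix.of fun i j => ξ j ((Fintype.equivFin (WithBot P)).symm i)).map
          (Int.cast : ℤ → Frac k P) i j := by
    ext i j
    rw [Module.Basis.toMatrix_apply, D_laurentMonomial, map_sum, Finset.sum_apply']
    simp only [map_smul, Module.Basis.repr_self, Finsupp.smul_single, smul_eq_mul, mul_one]
    simp [Finsupp.single_apply]
  rw [Module.Basis.det_apply, h, Matrix.det_mul_row, ← laurentMonomial_sum, Int.cast_det, mul_comm]

variable {k P}

theorem smul_volumeForm_eq_iff {f : Frac k P} {a : Fin (Fintype.card (WithBot P)) → Frac k P} :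
    f • volumeForm k P = exteriorPower.ιMulti (Frac k P) (Fintype.card (WithBot P))
      (fun i => KaehlerDifferential.D k (Frac k P) (a i)) ↔
    f = (logBasis k P).det fun i => KaehlerDifferential.D k (Frac k P) (a i) := by
  rw [alternatingMap_eq_det_smul (logBasis k P), ← volumeForm_eq]
  exact smul_left_inj (volumeForm_ne_zero k P)

end Differentials

section FacetWeight

variable {P : Type*} [PartialOrder P]

open Classical in
/-- The indicator of the poset ideal generated by `w` and, if `u < w`, also by `v`. For a covering
`u ⋖ v`, exactly one of these ideals contains `u` but not `v`: the one for `w = u`. -/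
def facetWeight (u v : Hat P) (w x : WithBot P) : ℤ :=
  if x ≤ w ∨ ((x : Hat P) ≤ v ∧ u < w) then 1 else 0

open Classical in
theorem hatExt_facetWeight_sub {u v : Hat P} (huv : u ⋖ v) (w : WithBot P) :
    hatExt (facetWeight u v w) u - hatExt (facetWeight u v w) v =
      if (w : Hat P) = u then 1 else 0 := by
  obtain ⟨u, rfl⟩ := WithTop.ne_top_iff_exists.1 (huv.lt.trans_le le_top).ne
  have hu : hatExt (facetWeight u v w) u = if u ≤ w then 1 else 0 := by
    have : u < w → u ≤ w := le_of_lt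
    rw [hatExt_coe, facetWeight]
    simp only [WithTop.coe_lt_coe]
    congr 1
    simp only [eq_iff_iff]
    tauto
  have hv : hatExt (facetWeight u v w) v = if u < w then 1 else 0 := by
    induction v using WithTop.recTopCoe with
    | top =>
      rw [hatExt_top, if_neg]
      intro h
      exact huv.2 (WithTop.coe_lt_coe.2 h) (WithTop.coe_lt_top w)
    | coe v =>
      have : v ≤ w → u < w := (WithTop.coe_lt_coe.1 huv.lt).trans_le
      rw [hatExt_coe, facetWeight]
      simp only [WithTop.coe_lt_coe, le_refl, true_and]
      congr 1
      simp only [eq_iff_iff]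
      tauto
  rw [hu, hv]
  simp only [WithTop.coe_inj]
  rcases eq_or_ne w u with rfl | h
  · simp
  · rw [if_neg h]
    have : u ≤ w ↔ u < w := ⟨fun h' => h'.lt_of_ne h.symm, le_of_lt⟩
    simp only [this, sub_self]

end FacetWeight

section CanonicalModule

variable {k P : Type*} [Field k] [PartialOrder P] [Fintype P]

/-- Linearly independent vectors in the cone of the Hibi ring do not all lie on one facet. -/
theorem sum_mem_weights_neg_one {ξ : Fin (Fintype.card (WithBot P)) → WithBot P → ℤ}
    (hξ : ∀ j, ξ j ∈ weights P 0)
    (hdet : (Matrix.of fun i j => ξ j ((Fintype.equivFin (WithBot P)).symm i)).det ≠ 0) :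
    ∑ j, ξ j ∈ weights P (-1) := by
  intro u v huv
  have hsum : ∀ w : Hat P, hatExt (∑ j, ξ j) w = ∑ j, hatExt (ξ j) w := by
    intro w
    induction w using WithTop.recTopCoe <;> simp
  have hle : ∀ j, hatExt (ξ j) v ≤ hatExt (ξ j) u := fun j => by simpa using hξ j u v huv
  rw [hsum, hsum]
  suffices ∑ j, hatExt (ξ j) v < ∑ j, hatExt (ξ j) u by omega
  refine Finset.sum_lt_sum (fun j _ => hle j) ?_
  -- otherwise the rows of `u` and `v` agree (the row of `∞` being zero)
  by_contra! h
  have heq : ∀ j, hatExt (ξ j) u = hatExt (ξ j) v :=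
    fun j => le_antisymm (h j (Finset.mem_univ _)) (hle j)
  obtain ⟨u, rfl⟩ := WithTop.ne_top_iff_exists.1 (huv.lt.trans_le le_top).ne
  refine hdet ?_
  induction v using WithTop.recTopCoe with
  | top =>
    refine Matrix.det_eq_zero_of_row_eq_zero (Fintype.equivFin _ u) fun j => ?_
    simpa using heq j
  | coe v =>
    refine Matrix.det_zero_of_row_eq (i := Fintype.equivFin _ u) (j := Fintype.equivFin _ v) ?_ ?_
    · rintro h
      have := (Fintype.equivFin _).injective h
      subst this
      exact huv.lt.ne rfl
    · funext j
      simpa using heq j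

/-- The top forms lie in the span of the monomials of the interior of the cone. -/
theorem topForms_le {f : Frac k P} (hf : f ∈ topForms k (hibiRing k P) (volumeForm k P)) :
    f ∈ laurentSpan k P (weights P (-1)) := by
  induction hf using Submodule.span_induction with
  | mem f hf =>
    obtain ⟨a, ha⟩ := hf
    rw [smul_volumeForm_eq_iff] at ha
    rw [ha]
    refine multilinearMap_mem_of_mem_span
      (((logBasis k P).det.toMultilinearMap.restrictScalars k).compLinearMap fun _ =>
        (KaehlerDifferential.D k (Frac k P)).toLinearMap)
      (laurentSpan k P (weights P (-1))) (laurentMonomial k P '' weights P 0) ?_ _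
      fun i => algebraMap_mem_laurentSpan (a i)
    intro b hb
    choose ξ hξ hξb using hb
    obtain rfl : (fun j => laurentMonomial k P (ξ j)) = b := funext hξb
    change (logBasis k P).det
      (fun j => KaehlerDifferential.D k (Frac k P) (laurentMonomial k P (ξ j))) ∈ _
    rw [logBasis_det_laurentMonomial]
    by_cases hdet : (Matrix.of fun i j => ξ j ((Fintype.equivFin (WithBot P)).symm i)).det = 0
    · simp [hdet]
    · rw [← zsmul_eq_mul]
      exact zsmul_mem (laurentMonomial_mem_laurentSpan.2 (sum_mem_weights_neg_one hξ hdet)) _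
  | zero => exact Submodule.zero_mem _
  | add x y _ _ hx hy => exact Submodule.add_mem _ hx hy
  | smul r x _ hx =>
    exact smul_mem_laurentSpan hx r fun ξ hξ ζ hζ => by simpa using add_mem_weights hξ hζ

theorem facetWeight_mem_weights_zero (u v : Hat P) (w : WithBot P) :
    facetWeight u v w ∈ weights P 0 := by
  rw [mem_weights_zero_iff]
  constructor
  · intro x y hxy
    have h1 : y ≤ w → x ≤ w := hxy.trans
    have h2 : (y : Hat P) ≤ v → (x : Hat P) ≤ v := (WithTop.coe_le_coe.2 hxy).trans
    unfold facetWeight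
    split_ifs <;> tauto
  · intro x
    unfold facetWeight
    split_ifs <;> simp

theorem det_facetWeight {u v : Hat P} (huv : u ⋖ v) [DecidableEq (WithBot P)] :
    (Matrix.of fun x w => facetWeight u v w x).det = 1 := by
  classical
  -- the matrix is unitriangular if the elements above `u` other than `v` come last
  refine det_eq_one_of_weight (fun x : WithBot P =>
    (if u < x ∧ (x : Hat P) ≠ v then Fintype.card (WithBot P) + 1 else 0) +
      (Finset.univ.filter (· ≤ x)).card) (fun x => ?_) fun x w hxw h => ?_
  · simp [facetWeight]
  · have hcard : (Finset.univ.filter (· ≤ x)).card ≤ Fintype.card (WithBot P) :=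
      Finset.card_le_univ _
    rw [Matrix.of_apply, facetWeight, ne_eq, ite_eq_right_iff, Classical.not_imp] at h
    have hxv : u < x → (x : Hat P) ≤ v → (x : Hat P) = v :=
      fun h1 h2 => by_contra fun h3 => huv.2 h1 (h2.lt_of_ne h3)
    by_cases hle : x ≤ w
    · have hlt := hle.lt_of_ne hxw
      have h1 : (Finset.univ.filter (· ≤ x)).card < (Finset.univ.filter (· ≤ w)).card := by
        refine Finset.card_lt_card (Finset.ssubset_iff_of_subset ?_ |>.2 ⟨w, by simp, ?_⟩)
        · intro y hy
          simp only [Finset.mem_filter, Finset.mem_univ, true_and] at hy ⊢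
          exact hy.trans hle
        · simpa using hlt.not_ge
      have h2 : u < x ∧ (x : Hat P) ≠ v → u < w ∧ (w : Hat P) ≠ v := by
        rintro ⟨h3, -⟩
        refine ⟨h3.trans (WithTop.coe_lt_coe.2 hlt), ?_⟩
        rintro rfl
        exact huv.2 h3 (WithTop.coe_lt_coe.2 hlt)
      split_ifs <;> first | omega | tauto
    · obtain ⟨hxv', huw⟩ := h.1.resolve_left hle
      have h1 : (w : Hat P) ≠ v := by
        rintro rfl
        exact hle (WithTop.coe_le_coe.1 hxv')
      rw [if_neg (by tauto), if_pos ⟨huw, h1⟩]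
      omega

/-- For every covering `u ⋖ v` there is a monomial in the module of top forms whose exponent vector
is as close as possible to the facet `ξ(u) = ξ(v)` of the cone of the Hibi ring. -/
theorem exists_laurentMonomial_mem_topForms {u v : Hat P} (huv : u ⋖ v) :
    ∃ ζ : WithBot P → ℤ, laurentMonomial k P ζ ∈ topForms k (hibiRing k P) (volumeForm k P) ∧
      hatExt ζ u = hatExt ζ v + 1 := by
  classical
  let σ := Fintype.equivFin (WithBot P)
  refine ⟨∑ j, facetWeight u v (σ.symm j), Submodule.subset_span ?_, ?_⟩
  · choose a ha using fun j => exists_algebraMap_eq_laurentMonomial (k := k)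
      (facetWeight_mem_weights_zero u v (σ.symm j))
    refine ⟨a, ?_⟩
    rw [smul_volumeForm_eq_iff]
    simp only [ha]
    rw [logBasis_det_laurentMonomial]
    have h1 : (Matrix.of fun i j => facetWeight u v (σ.symm j) (σ.symm i)).det = 1 := by
      rw [← det_facetWeight huv, ← Matrix.det_submatrix_equiv_self σ.symm]
      rfl
    rw [h1, Int.cast_one, one_mul]
  · have hsum : ∀ w : Hat P, hatExt (∑ j, facetWeight u v (σ.symm j)) w =
        ∑ j, hatExt (facetWeight u v (σ.symm j)) w := by
      intro w
      induction w using WithTop.recTopCoe <;> simp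
    rw [hsum, hsum, ← sub_eq_iff_eq_add', ← Finset.sum_sub_distrib]
    rw [Equiv.sum_comp σ.symm fun w => hatExt (facetWeight u v w) u - hatExt (facetWeight u v w) v]
    simp only [hatExt_facetWeight_sub huv]
    obtain ⟨u, rfl⟩ := WithTop.ne_top_iff_exists.1 (huv.lt.trans_le le_top).ne
    simp

end CanonicalModule

/-! ### The modules `ω^(-n)` -/

section Duality

variable {R K : Type*} [CommRing R] [Field K] [Algebra R K]

theorem dual_anti {I J : Submodule R K} (h : I ≤ J) : dual J ≤ dual I := fun _ hx =>
  mem_dual.2 fun y hy => mem_dual.1 hx y (h hy)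

theorem dual_dual_dual (J : Submodule R K) : dual (dual (dual J)) = dual J :=
  le_antisymm (dual_anti (le_dual_dual J)) (le_dual_dual _)

theorem dual_mul (I J : Submodule R K) : dual (I * J) = dual J / I := by
  ext x
  rw [mem_dual, Submodule.mem_div_iff_forall_mul_mem]
  simp only [mem_dual]
  refine ⟨fun h y hy z hz => ?_, fun h w hw => ?_⟩
  · rw [mul_assoc]
    exact h _ (Submodule.mul_mem_mul hy hz)
  · refine Submodule.mul_induction_on hw (fun y hy z hz => ?_) fun y z hy hz => ?_
    · rw [← mul_assoc]
      exact h y hy z hz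
    · rw [mul_add]
      exact Submodule.add_mem _ hy hz

/-- Passing to the reflexive hull before taking powers does not change the dual. -/
theorem dual_pow_dual_dual (J : Submodule R K) (n : ℕ) :
    dual (dual (dual J) ^ n) = dual (J ^ n) := by
  induction n with
  | zero => simp
  | succ n ih =>
    rw [pow_succ', pow_succ, dual_mul, mul_comm (J ^ n), dual_mul, ih, ← dual_mul,
      mul_comm, dual_mul, dual_dual_dual, ← dual_mul, mul_comm, dual_mul]

end Duality

section Anticanonical

variable {k P : Type*} [Field k] [PartialOrder P] [Fintype P]

theorem omegaNeg_eq (n : ℕ) :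
    omegaNeg k P n = dual (topForms k (hibiRing k P) (volumeForm k P) ^ n) := by
  rw [omegaNeg, negSymbolicPower_eq, omega, canonicalIdeal, dual_pow_dual_dual]

theorem pow_topForms_le (n : ℕ) {f : Frac k P}
    (hf : f ∈ topForms k (hibiRing k P) (volumeForm k P) ^ n) :
    f ∈ laurentSpan k P (weights P (-n)) := by
  induction n generalizing f with
  | zero =>
    rw [pow_zero, mem_one_iff_mem_laurentSpan] at hf
    simpa using hf
  | succ n ih =>
    rw [pow_succ] at hf
    refine Submodule.mul_induction_on hf (fun y hy z hz => ?_) fun y z hy hz => ?_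
    · refine mul_mem_laurentSpan (ih hy) (topForms_le hz) fun ξ hξ ζ hζ => ?_
      have := add_mem_weights hξ hζ
      rwa [← neg_add, ← Nat.cast_succ] at this
    · exact Submodule.add_mem _ hy hz

/-- `ω^(-n)` is spanned by the monomials `x^ξ` with `ξ(u) - ξ(v) ≥ -n` for all `u ⋖ v` in `P̂`. -/
theorem mem_omegaNeg_iff {n : ℕ} {f : Frac k P} :
    f ∈ omegaNeg k P n ↔ f ∈ laurentSpan k P (weights P n) := by
  rw [omegaNeg_eq, mem_dual]
  constructor
  · intro h
    have hne : Nonempty {p : Hat P × Hat P // p.1 ⋖ p.2} := by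
      obtain ⟨p, hc, hh, hl⟩ := exists_isUpwardPath (bot_le : (⊥ : Hat P) ≤ ⊤)
      obtain ⟨l, rfl⟩ := List.head?_eq_some_iff.1 hh
      cases l with
      | nil => simp at hl
      | cons w l => exact ⟨⟨(⊥, w), (List.isChain_cons_cons.1 hc).1⟩⟩
    refine laurentSpan_mono (A := ⋂ p : {p : Hat P × Hat P // p.1 ⋖ p.2},
      {ξ | hatExt ξ p.1.2 ≤ hatExt ξ p.1.1 + n}) ?_ (mem_laurentSpan_iInter.2 ?_)
    · intro ξ hξ u v huv
      exact Set.mem_iInter.1 hξ ⟨(u, v), huv⟩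
    · rintro ⟨⟨u, v⟩, huv⟩
      obtain ⟨ζ, hζ, hζuv⟩ := exists_laurentMonomial_mem_topForms (k := k) huv
      have h1 := h _ (Submodule.pow_mem_pow _ hζ n)
      rw [← laurentMonomial_nsmul, mem_one_iff_mem_laurentSpan,
        mul_laurentMonomial_mem_laurentSpan] at h1
      have hn : ∀ w : Hat P, hatExt (n • ζ) w = n * hatExt ζ w := by
        intro w
        induction w using WithTop.recTopCoe <;> simp
      refine laurentSpan_mono (fun ξ hξ => ?_) h1
      have h2 := hξ u v huv
      rw [hatExt_add, hatExt_add, hn, hn, hζuv, mul_add] at h2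
      rw [Set.mem_ofPred_eq]
      linarith
  · intro hf y hy
    rw [mem_one_iff_mem_laurentSpan]
    exact mul_mem_laurentSpan hf (pow_topForms_le n hy) fun ξ hξ ζ hζ => by
      simpa using add_mem_weights hξ hζ

theorem laurentMonomial_mem_omegaNeg_iff {n : ℕ} {ξ : WithBot P → ℤ} :
    laurentMonomial k P ξ ∈ omegaNeg k P n ↔ ξ ∈ weights P n := by
  rw [mem_omegaNeg_iff, laurentMonomial_mem_laurentSpan]

/-- Levelness says that the elements of least degree generate: the generating degree `j` cannot
exceed the degree `-ℓ` of the element `-d` of `weights 1`, where `d` is the distance to `∞`. -/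
theorem exists_minWeights_of_isAnticanonicalLevel (h : IsAnticanonicalLevel k P) :
    ∀ ξ ∈ weights P 1, ∃ μ ∈ minWeights P 1, ξ - μ ∈ weights P 0 := by
  obtain ⟨j, hj⟩ := h
  have key : ∀ ξ ∈ weights P 1, ∃ μ ∈ weights P 1, μ ⊥ = j ∧ ξ - μ ∈ weights P 0 := by
    intro ξ hξ
    have h1 : laurentMonomial k P ξ ∈ omegaNeg k P 1 :=
      laurentMonomial_mem_omegaNeg_iff.2 (by simpa using hξ)
    have h2 : ∀ f ∈ omegaNeg k P 1,
        f ∈ laurentSpan k P {ξ | ∃ μ ∈ weights P 1, μ ⊥ = j ∧ ξ - μ ∈ weights P 0} := by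
      intro f hf
      rw [← hj] at hf
      induction hf using Submodule.span_induction with
      | mem f hf =>
        have h3 : f ∈ laurentSpan k P (weights P 1 ∩ {ξ | ξ ⊥ = j}) := by
          rw [laurentSpan_inter]
          exact Submodule.mem_inf.2 ⟨by simpa using mem_omegaNeg_iff.1 hf.1, hf.2⟩
        refine laurentSpan_mono (fun ξ hξ => ?_) h3
        exact ⟨ξ, hξ.1, hξ.2, by simpa using zero_mem_weights_zero⟩
      | zero => exact Submodule.zero_mem _
      | add x y _ _ hx hy => exact Submodule.add_mem _ hx hy
      | smul r x _ hx =>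
        refine smul_mem_laurentSpan hx r ?_
        rintro ξ hξ ζ ⟨μ, hμ, hμj, hμ'⟩
        refine ⟨μ, hμ, hμj, ?_⟩
        rw [add_sub_assoc]
        simpa using add_mem_weights hξ hμ'
    exact laurentMonomial_mem_laurentSpan.1 (h2 _ h1)
  have hjle : j ≤ -(1 : ℕ) * coverDist (⊥ : Hat P) ⊤ := by
    obtain ⟨μ, -, hμj, hμ⟩ := key _ (by simpa using neg_coverDist_mem_weights (P := P) 1)
    have := nonneg_of_mem_weights_zero hμ ⊥
    rw [Pi.sub_apply, hμj] at this
    simpa using this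
  intro ξ hξ
  obtain ⟨μ, hμ, hμj, hμ'⟩ := key ξ hξ
  have hμ1 : μ ∈ weights P (1 : ℕ) := by simpa using hμ
  exact ⟨μ, ⟨hμ1, le_antisymm (hμj ▸ hjle) (bot_ge_of_mem_weights hμ1)⟩, hμ'⟩

end Anticanonical

/-! ### Minimal numbers of generators -/

section MinimalGenerators

variable {k P : Type*} [Field k] [PartialOrder P] [Fintype P]

theorem add_mem_weights_diff_minWeights {m n : ℕ} {ξ ζ : WithBot P → ℤ} (hξ : ξ ∈ weights P m)
    (hζ : ζ ∈ weights P n \ minWeights P n) :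
    ξ + ζ ∈ weights P (m + n : ℕ) \ minWeights P (m + n) := by
  refine ⟨by simpa using add_mem_weights hξ hζ.1, fun h => hζ.2 ⟨hζ.1, ?_⟩⟩
  have h1 := h.2
  have h2 := bot_ge_of_mem_weights hξ
  have h3 := bot_ge_of_mem_weights hζ.1
  rw [Pi.add_apply] at h1
  push_cast at h1
  linarith

theorem disjoint_laurentSpan_minWeights (n : ℕ) :
    Disjoint (laurentSpan k P (minWeights P n))
      (laurentSpan k P (weights P n \ minWeights P n)) := by
  rw [disjoint_iff, ← laurentSpan_inter, Set.inter_sdiff_self, laurentSpan, Set.image_empty,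
    Submodule.span_empty]

theorem smul_one_smul (c : k) (f : Frac k P) : (c • (1 : hibiRing k P)) • f = c • f := by
  rw [Algebra.smul_def, smul_eq_algebraMap_mul, map_one, smul_mul_assoc, one_mul]

theorem span_minWeights_eq_omegaNeg
    (hl : ∀ ξ ∈ weights P 1, ∃ μ ∈ minWeights P 1, ξ - μ ∈ weights P 0) (n : ℕ) :
    Submodule.span (hibiRing k P) (laurentMonomial k P '' minWeights P n) = omegaNeg k P n := by
  apply le_antisymm
  · rw [Submodule.span_le]
    rintro _ ⟨μ, hμ, rfl⟩
    exact laurentMonomial_mem_omegaNeg_iff.2 hμ.1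
  · intro f hf
    rw [mem_omegaNeg_iff] at hf
    induction hf using Submodule.span_induction with
    | mem f hf =>
      obtain ⟨ξ, hξ, rfl⟩ := hf
      obtain ⟨μ, hμ, hμ'⟩ := exists_minWeights_of_mem_weights hl n ξ hξ
      obtain ⟨r, hr⟩ := exists_algebraMap_eq_laurentMonomial (k := k) hμ'
      have h1 : laurentMonomial k P ξ = r • laurentMonomial k P μ := by
        rw [Algebra.smul_def, hr, ← laurentMonomial_add, sub_add_cancel]
      rw [h1]
      exact Submodule.smul_mem _ _ (Submodule.subset_span ⟨μ, hμ, rfl⟩)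
    | zero => exact Submodule.zero_mem _
    | add x y _ _ hx hy => exact Submodule.add_mem _ hx hy
    | smul c x _ hx =>
      rw [← smul_one_smul]
      exact Submodule.smul_mem _ _ hx

/-- Modulo the monomials outside `minWeights n`, the Hibi ring acts on `ω^(-n)` through its residue
field `k`. -/
theorem smul_mem_span_sup {n : ℕ} {f : Frac k P} (hf : f ∈ omegaNeg k P n) (r : hibiRing k P) :
    r • f ∈ Submodule.span k {f} ⊔ laurentSpan k P (weights P n \ minWeights P n) := by
  rw [mem_omegaNeg_iff] at hf
  rw [Algebra.smul_def]
  have hr := algebraMap_mem_laurentSpan r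
  generalize algebraMap (hibiRing k P) (Frac k P) r = x at hr ⊢
  induction hr using Submodule.span_induction with
  | mem x hx =>
    obtain ⟨ξ, hξ, rfl⟩ := hx
    by_cases h0 : ξ = 0
    · rw [h0, laurentMonomial_zero, one_mul]
      exact Submodule.mem_sup_left (Submodule.mem_span_singleton_self f)
    · refine Submodule.mem_sup_right ?_
      rw [mul_comm]
      refine mul_mem_laurentSpan hf (B := {ξ}) (laurentMonomial_mem_laurentSpan.2 rfl) ?_
      rintro ζ hζ _ rfl
      have := add_mem_weights_diff_minWeights (n := 0) hζ
        ⟨by simpa using hξ, fun h => h0 (mem_minWeights_zero_iff.1 h)⟩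
      simpa using this
  | zero => rw [zero_mul]; exact Submodule.zero_mem _
  | add x y _ _ hx hy => rw [add_mul]; exact Submodule.add_mem _ hx hy
  | smul c x _ hx => rw [smul_mul_assoc]; exact Submodule.smul_mem _ _ hx

/-- The monomials of `minWeights n` form a minimal system of generators of `ω^(-n)`: they are
linearly independent modulo the monomials that are not of least degree. -/
theorem spanFinrank_omegaNeg
    (hl : ∀ ξ ∈ weights P 1, ∃ μ ∈ minWeights P 1, ξ - μ ∈ weights P 0) (n : ℕ) :
    (omegaNeg k P n).spanFinrank = (minWeights P n).ncard := by
  have hfin := (finite_minWeights_and_ncard_le (P := P) n).1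
  have hspan := span_minWeights_eq_omegaNeg (k := k) hl n
  apply le_antisymm
  · rw [← hspan]
    exact (Submodule.spanFinrank_span_le_ncard_of_finite (hfin.image _)).trans
      (Set.ncard_image_le hfin)
  · have hfg : (omegaNeg k P n).FG := hspan ▸ Submodule.fg_span (hfin.image _)
    obtain ⟨s, hs, hss⟩ := hfg.exists_span_finset_card_eq_spanFinrank
    rw [← hs]
    set N := laurentSpan k P (weights P n \ minWeights P n) with hN
    have h1 : ∀ f ∈ omegaNeg k P n, f ∈ Submodule.span k (s : Set (Frac k P)) ⊔ N := by
      intro f hf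
      have hsub : ∀ g ∈ s, g ∈ omegaNeg k P n := fun g hg => hss ▸ Submodule.subset_span hg
      rw [← hss] at hf
      induction hf using Submodule.span_induction with
      | mem f hf => exact Submodule.mem_sup_left (Submodule.subset_span hf)
      | zero => exact Submodule.zero_mem _
      | add x y _ _ hx hy => exact Submodule.add_mem _ hx hy
      | smul r x hx' hx =>
        have h2 : Submodule.span k {x} ⊔ N ≤ Submodule.span k (s : Set (Frac k P)) ⊔ N := by
          refine sup_le ?_ le_sup_right
          rwa [Submodule.span_le, Set.singleton_subset_iff]
        exact h2 (smul_mem_span_sup (hss ▸ hx') r)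
    have := hfin.fintype
    have hli : LinearIndependent k (N.mkQ ∘ fun μ : minWeights P n => laurentMonomial k P μ) := by
      refine ((linearIndependent_laurentMonomial k P).comp _ Subtype.val_injective).map ?_
      rw [Submodule.ker_mkQ]
      refine (disjoint_laurentSpan_minWeights n).mono_left (Submodule.span_mono ?_)
      rintro _ ⟨μ, rfl⟩
      exact ⟨μ, μ.2, rfl⟩
    classical
    calc (minWeights P n).ncard = Module.finrank k (Submodule.span k (Set.range
          (N.mkQ ∘ fun μ : minWeights P n => laurentMonomial k P μ))) := by
          rw [finrank_span_eq_card hli, ← Nat.card_eq_fintype_card, Nat.card_coe_set_eq]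
      _ ≤ Module.finrank k (Submodule.span k
            ((s.image N.mkQ : Finset _) : Set (Frac k P ⧸ N))) := by
          refine Submodule.finrank_mono (Submodule.span_le.2 ?_)
          rintro _ ⟨μ, rfl⟩
          have h2 := Submodule.mem_map_of_mem (f := N.mkQ)
            (h1 _ (laurentMonomial_mem_omegaNeg_iff.2 μ.2.1))
          rw [Submodule.map_sup, Submodule.map_span, Submodule.mkQ_map_self, sup_bot_eq] at h2
          rwa [Finset.coe_image]
      _ ≤ (s.image N.mkQ).card := finrank_span_finset_le_card _
      _ ≤ s.card := Finset.card_image_le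

end MinimalGenerators

/-! ### Krull dimension of affine domains -/

section KrullDimension

/-- An injective integral extension preserves the Krull dimension: primes can be lifted along
chains by going up, and they contract strictly by incomparability. -/
theorem ringKrullDim_eq_of_isIntegral {A B : Type*} [CommRing A] [CommRing B] [Algebra A B]
    [Algebra.IsIntegral A B] (hinj : Function.Injective (algebraMap A B)) :
    ringKrullDim B = ringKrullDim A := by
  have := (faithfulSMul_iff_algebraMap_injective A B).2 hinj
  apply le_antisymm
  · refine Order.krullDim_le_of_strictMono (PrimeSpectrum.comap (algebraMap A B)) ?_
    intro p q hpq
    exact Ideal.IsIntegral.comap_lt_comap (R := A) (I := p.asIdeal) (J := q.asIdeal) hpq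
  · refine iSup_le fun l => ?_
    obtain ⟨Q, hQ, hQl⟩ : (Ideal.primesOver l.head.asIdeal B).Nonempty :=
      Set.nonempty_coe_sort.1 inferInstance
    obtain ⟨L, hL, -⟩ := Ideal.exists_ltSeries_of_hasGoingUp l Q
    rw [← hL]
    exact Order.LTSeries.length_le_krullDim L

/-- By Noether normalization, an affine domain has its transcendence degree as Krull dimension. -/
theorem ringKrullDim_eq_of_trdeg_eq (k B : Type*) [Field k] [CommRing B] [IsDomain B] [Algebra k B]
    [Algebra.FiniteType k B] {n : ℕ} (hn : Algebra.trdeg k B = n) : ringKrullDim B = n := by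
  obtain ⟨s, g, hg, hint⟩ := exists_integral_inj_algHom_of_fg k B
  algebraize [g.toRingHom]
  have h1 : ringKrullDim B = s := by
    rw [ringKrullDim_eq_of_isIntegral (A := MvPolynomial (Fin s) k) hg,
      MvPolynomial.ringKrullDim_of_isNoetherianRing, ringKrullDim_eq_zero_of_field]
    simp
  have : FaithfulSMul (MvPolynomial (Fin s) k) B :=
    (faithfulSMul_iff_algebraMap_injective _ _).2 hg
  have : IsScalarTower k (MvPolynomial (Fin s) k) B := IsScalarTower.of_algHom g
  have h2 := lift_trdeg_add_eq k (MvPolynomial (Fin s) k) B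
  rw [MvPolynomial.trdeg_of_isDomain, trdeg_eq_zero, hn] at h2
  simp at h2
  rw [h1]
  exact_mod_cast h2

end KrullDimension

/-! ### The algebra of the monomials of least degree -/

section GradedMonomials

variable (k : Type*) {P : Type*} [Field k] [Fintype P]

/-- The monomial `x^ξ T^n`. -/
def gradedMonomial (n : ℕ) (ξ : WithBot P → ℤ) : (Frac k P)[X] :=
  Polynomial.monomial n (laurentMonomial k P ξ)

variable {k}

theorem gradedMonomial_mul (m n : ℕ) (ξ ζ : WithBot P → ℤ) :
    gradedMonomial k m ξ * gradedMonomial k n ζ = gradedMonomial k (m + n) (ξ + ζ) := by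
  rw [gradedMonomial, gradedMonomial, Polynomial.monomial_mul_monomial, ← laurentMonomial_add,
    gradedMonomial]

theorem gradedMonomial_zero : gradedMonomial k 0 (0 : WithBot P → ℤ) = 1 := by
  rw [gradedMonomial, laurentMonomial_zero, Polynomial.monomial_zero_one]

theorem gradedMonomial_pow (n : ℕ) (ξ : WithBot P → ℤ) (m : ℕ) :
    gradedMonomial k n ξ ^ m = gradedMonomial k (m * n) (m • ξ) := by
  induction m with
  | zero => rw [pow_zero, zero_mul, zero_smul, gradedMonomial_zero]
  | succ m ih => rw [pow_succ, ih, gradedMonomial_mul, succ_nsmul, Nat.succ_mul]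

theorem prod_gradedMonomial {ι : Type*} (s : Finset ι) (n : ι → ℕ) (ξ : ι → WithBot P → ℤ) :
    ∏ i ∈ s, gradedMonomial k (n i) (ξ i) = gradedMonomial k (∑ i ∈ s, n i) (∑ i ∈ s, ξ i) := by
  classical
  induction s using Finset.induction_on with
  | empty => simp [gradedMonomial_zero]
  | insert a s ha ih =>
    rw [Finset.prod_insert ha, Finset.sum_insert ha, Finset.sum_insert ha, ih, gradedMonomial_mul]

theorem linearIndependent_gradedMonomial :
    LinearIndependent k fun p : (WithBot P → ℤ) × ℕ => gradedMonomial k p.2 p.1 := by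
  have h := linearIndependent_smul (linearIndependent_laurentMonomial k P)
    (Polynomial.basisMonomials (Frac k P)).linearIndependent
  convert! h using 2 with p
  rw [Polynomial.coe_basisMonomials, Polynomial.smul_monomial, smul_eq_mul, mul_one, gradedMonomial]

end GradedMonomials

section MinimalDegree

variable {k P : Type*} [Field k] [PartialOrder P] [Fintype P]

/-- The monomials of least degree are products of the monomials in `minWeights 1`. -/
theorem mem_adjoin_gradedMonomial {S : Type*} [CommRing S] [Algebra S (Frac k P)]
    {f : (Frac k P)[X]}
    (hf : ∀ n, f.coeff n ∈ Submodule.span S (laurentMonomial k P '' minWeights P n)) :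
    f ∈ Algebra.adjoin S (gradedMonomial k 1 '' minWeights P 1) := by
  have key : ∀ n, ∀ μ ∈ minWeights P n,
      gradedMonomial k n μ ∈ Algebra.adjoin S (gradedMonomial k 1 '' minWeights P 1) := by
    intro n
    induction n with
    | zero =>
      intro μ hμ
      rw [mem_minWeights_zero_iff.1 hμ, gradedMonomial_zero]
      exact one_mem _
    | succ n ih =>
      intro μ hμ
      obtain ⟨ζ, hζ, χ, hχ, rfl⟩ := exists_add_of_mem_minWeights_succ hμ
      rw [add_comm n, ← gradedMonomial_mul]
      exact mul_mem (Algebra.subset_adjoin ⟨ζ, hζ, rfl⟩) (ih χ hχ)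
  rw [f.as_sum_support]
  refine sum_mem fun n _ => ?_
  have h := hf n
  generalize f.coeff n = c at h
  induction h using Submodule.span_induction with
  | mem x hx =>
    obtain ⟨μ, hμ, rfl⟩ := hx
    exact key n μ hμ
  | zero => rw [map_zero]; exact zero_mem _
  | add x y _ _ hx hy => rw [map_add]; exact add_mem hx hy
  | smul r x _ hx => rw [← Polynomial.smul_monomial]; exact Subalgebra.smul_mem _ hx r

theorem anticanonicalAlgebra_fg
    (hl : ∀ ξ ∈ weights P 1, ∃ μ ∈ minWeights P 1, ξ - μ ∈ weights P 0) :
    (anticanonicalAlgebra k P).FG := by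
  rw [Subalgebra.fg_def]
  refine ⟨gradedMonomial k 1 '' minWeights P 1,
    (finite_minWeights_and_ncard_le 1).1.image _, le_antisymm (Algebra.adjoin_le ?_) fun f hf => ?_⟩
  · rintro _ ⟨μ, hμ, rfl⟩ n
    rw [gradedMonomial, Polynomial.coeff_monomial]
    split_ifs with h
    · subst h
      exact laurentMonomial_mem_omegaNeg_iff.2 hμ.1
    · exact Submodule.zero_mem _
  · refine mem_adjoin_gradedMonomial fun n => ?_
    rw [span_minWeights_eq_omegaNeg hl]
    exact hf n

variable (k P) in
/-- The `k`-subalgebra of `⨁ ω^(-n)` spanned by the monomials `x^ξ T^n` with `ξ ∈ minWeights n`. -/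
def minAlgebra : Subalgebra k (Frac k P)[X] where
  carrier := {f | ∀ n, f.coeff n ∈ laurentSpan k P (minWeights P n)}
  mul_mem' := by
    intro f g hf hg n
    rw [Polynomial.coeff_mul]
    refine Submodule.sum_mem _ ?_
    rintro ⟨i, j⟩ hij
    rw [← Finset.HasAntidiagonal.mem_antidiagonal.1 hij]
    exact mul_mem_laurentSpan (hf i) (hg j) fun ξ hξ ζ hζ => add_mem_minWeights hξ hζ
  add_mem' := by
    intro f g hf hg n
    rw [Polynomial.coeff_add]
    exact Submodule.add_mem _ (hf n) (hg n)
  algebraMap_mem' := by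
    intro c n
    rw [Polynomial.algebraMap_apply, Polynomial.coeff_C]
    split_ifs with h
    · subst h
      rw [Algebra.algebraMap_eq_smul_one, ← laurentMonomial_zero]
      exact Submodule.smul_mem _ _
        (laurentMonomial_mem_laurentSpan.2 (mem_minWeights_zero_iff.2 rfl))
    · exact Submodule.zero_mem _

theorem gradedMonomial_mem_minAlgebra {n : ℕ} {μ : WithBot P → ℤ} (hμ : μ ∈ minWeights P n) :
    gradedMonomial k n μ ∈ minAlgebra k P := by
  intro m
  rw [gradedMonomial, Polynomial.coeff_monomial]
  split_ifs with h
  · subst h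
    exact laurentMonomial_mem_laurentSpan.2 hμ
  · exact Submodule.zero_mem _

theorem minAlgebra_eq_adjoin :
    minAlgebra k P = Algebra.adjoin k (gradedMonomial k 1 '' minWeights P 1) := by
  refine le_antisymm (fun f hf => mem_adjoin_gradedMonomial hf) (Algebra.adjoin_le ?_)
  rintro _ ⟨μ, hμ, rfl⟩
  exact gradedMonomial_mem_minAlgebra hμ

instance finiteType_minAlgebra : Algebra.FiniteType k (minAlgebra k P) := by
  rw [← Subalgebra.fg_iff_finiteType, Subalgebra.fg_def]
  exact ⟨_, (finite_minWeights_and_ncard_le 1).1.image _, minAlgebra_eq_adjoin.symm⟩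

end MinimalDegree

section TranscendenceDegree

variable {k P : Type*} [Field k] [PartialOrder P] [Fintype P]

/-- The exponent vector of the variable with index `v`; it is `0` for `v = ∞`. -/
def unitWeight (v : Hat P) (x : WithBot P) : ℤ :=
  open Classical in if (x : Hat P) = v then 1 else 0

/-- `minAlgebra` lies in a polynomial ring: the one generated by `x^(-d) T`, where `d` is the
distance to `∞`, and by the variables `x_v`, `v ∈ P̂_nonmin`. -/
theorem trdeg_minAlgebra_le :
    Algebra.trdeg k (minAlgebra k P) ≤ ((hatNonmin P).ncard + 1 : ℕ) := by
  classical
  have := Fintype.ofFinite (hatNonmin P)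
  let D : WithBot P → ℤ := fun x => -coverDist (x : Hat P) ⊤
  let w : Option (hatNonmin P) → (Frac k P)[X] :=
    fun o => o.elim (gradedMonomial k 1 D) fun v => gradedMonomial k 0 (unitWeight (v : Hat P))
  let g : MvPolynomial (Option (hatNonmin P)) k →ₐ[k] (Frac k P)[X] := MvPolynomial.aeval w
  have hw : ∀ o, w o ∈ g.range := fun o => ⟨MvPolynomial.X o, MvPolynomial.aeval_X _ _⟩
  have hle : minAlgebra k P ≤ g.range := by
    rw [minAlgebra_eq_adjoin]
    refine Algebra.adjoin_le ?_
    rintro _ ⟨μ, hμ, rfl⟩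
    have h1 : gradedMonomial k 1 μ = w none * ∏ v : hatNonmin P,
        w (some v) ^ (hatExt μ v + coverDist (v : Hat P) ⊤).toNat := by
      change _ = gradedMonomial k 1 D *
        ∏ v : hatNonmin P, gradedMonomial k 0 (unitWeight (v : Hat P)) ^ _
      simp only [gradedMonomial_pow]
      rw [prod_gradedMonomial, gradedMonomial_mul]
      congr 1
      · simp
      · funext x
        have h2 : ∀ v : hatNonmin P, (((hatExt μ v + coverDist (v : Hat P) ⊤).toNat •
            unitWeight (v : Hat P) : WithBot P → ℤ) x) =
            if (x : Hat P) = v then hatExt μ v + coverDist (v : Hat P) ⊤ else 0 := by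
          intro v
          have h3 := neg_coverDist_le hμ.1 (v : Hat P)
          simp only [Pi.smul_apply, unitWeight, nsmul_eq_mul, mul_ite, mul_one, mul_zero]
          rw [Int.toNat_of_nonneg]
          push_cast at h3
          linarith
        rw [Pi.add_apply, Finset.sum_apply]
        simp only [h2]
        by_cases hx : (x : Hat P) ∈ hatNonmin P
        · rw [Finset.sum_eq_single ⟨(x : Hat P), hx⟩]
          · simp [D]
          · intro v _ hv
            rw [if_neg]
            rintro h
            exact hv (Subtype.ext h.symm)
          · simp
        · rw [Finset.sum_eq_zero]
          · have := hatExt_of_mem_minWeights hμ hx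
            simpa [D] using this
          · intro v _
            rw [if_neg]
            rintro h
            exact hx (h ▸ v.2)
    rw [h1]
    exact mul_mem (hw _) (prod_mem fun v _ => pow_mem (hw _) _)
  have h1 : Algebra.trdeg k (minAlgebra k P) ≤ Algebra.trdeg k g.range :=
    trdeg_le_of_injective (Subalgebra.inclusion hle) (Subalgebra.inclusion_injective hle)
  have h2 := lift_trdeg_le_of_surjective (R := k) (A' := g.range) g.rangeRestrict
    g.rangeRestrict_surjective
  rw [MvPolynomial.trdeg_of_isDomain] at h2
  have h3 := (Cardinal.lift_le.2 h1).trans h2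
  rw [Cardinal.mk_fintype, Fintype.card_option, ← Nat.card_eq_fintype_card,
    Nat.card_coe_set_eq] at h3
  simpa using h3

/-- The elements `x^a T^N` and `x^a x_v T^N`, `v ∈ P̂_nonmin`, of `minAlgebra` are algebraically
independent, where `x^a T^N` is such that `a` has positive slack along `P̂_nonmin`. -/
theorem le_trdeg_minAlgebra :
    ((hatNonmin P).ncard + 1 : ℕ) ≤ Algebra.trdeg k (minAlgebra k P) := by
  classical
  have := Fintype.ofFinite (hatNonmin P)
  set N := distBound P with hN
  have hN0 : 0 < N := Nat.succ_pos _
  let δ : Option (hatNonmin P) → Hat P → ℕ := fun o x => o.elim 0 fun v => if x = v then 1 else 0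
  let a : Option (hatNonmin P) → WithBot P → ℤ := fun o x => perturbedWeight N 1 (δ o) x
  have ha : ∀ o, a o ∈ minWeights P N := by
    intro o
    refine perturbedWeight_mem_minWeights (by simp [hN]) fun x => ?_
    rcases o with _ | v
    · simp [δ]
    · simp only [δ, Option.elim]
      split_ifs <;> simp
  have ha' : ∀ o x, a o x = a none x + δ o x := by
    intro o x
    simp only [a, perturbedWeight]
    split_ifs with h
    · simp [δ]
    · rcases o with _ | v
      · simp [δ]
      · have h1 : (x : Hat P) ≠ v := fun h' => h (h' ▸ v.2)
        simp [δ, h1]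
  let y : Option (hatNonmin P) → minAlgebra k P :=
    fun o => ⟨gradedMonomial k N (a o), gradedMonomial_mem_minAlgebra (ha o)⟩
  have hy : AlgebraicIndependent k y := by
    refine (AlgHom.algebraicIndependent_iff (minAlgebra k P).val Subtype.val_injective).1 ?_
    let E : (Option (hatNonmin P) →₀ ℕ) → (WithBot P → ℤ) × ℕ :=
      fun m => (∑ o, m o • a o, ∑ o, m o * N)
    have hE : Function.Injective E := by
      intro m m' h
      have h1 : ∑ o, m o = ∑ o, m' o := by
        have := congrArg Prod.snd h
        simp only [E, ← Finset.sum_mul] at this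
        exact Nat.eq_of_mul_eq_mul_right hN0 this
      have h2 : ∀ (m : Option (hatNonmin P) →₀ ℕ) (x : WithBot P), (∑ o, m o • a o) x =
          ((∑ o, m o : ℕ) : ℤ) * a none x + ∑ o, (m o : ℤ) * δ o x := by
        intro m x
        rw [Finset.sum_apply, Nat.cast_sum, Finset.sum_mul, ← Finset.sum_add_distrib]
        refine Finset.sum_congr rfl fun o _ => ?_
        rw [Pi.smul_apply, ha' o x, nsmul_eq_mul, mul_add]
      have h3 : ∀ v, m (some v) = m' (some v) := by
        rintro ⟨v, hv⟩
        obtain ⟨x, rfl⟩ : ∃ x : WithBot P, (x : Hat P) = v := by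
          rw [← WithTop.ne_top_iff_exists]
          rintro rfl
          exact mem_hatNonmin_iff_notMem_hatMin.1 hv top_mem_hatMin
        have h4 := congrFun (congrArg Prod.fst h) x
        simp only [E] at h4
        rw [h2, h2, h1, add_right_inj, Fintype.sum_option, Fintype.sum_option,
          Finset.sum_eq_single ⟨(x : Hat P), hv⟩, Finset.sum_eq_single ⟨(x : Hat P), hv⟩] at h4
        · simpa [δ] using h4
        all_goals first
          | simp; done
          | intro w _ hw
            have : (x : Hat P) ≠ w := fun h => hw (Subtype.ext h.symm)
            simp [δ, this]
      ext o
      rcases o with _ | v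
      · rw [Fintype.sum_option, Fintype.sum_option] at h1
        simp only [h3] at h1
        omega
      · exact h3 v
    have hli : LinearIndependent k fun m => gradedMonomial k (E m).2 (E m).1 :=
      linearIndependent_gradedMonomial.comp E hE
    have haev : (MvPolynomial.aeval fun o => (y o : (Frac k P)[X])).toLinearMap =
        Finsupp.linearCombination k (fun m => gradedMonomial k (E m).2 (E m).1) ∘ₗ
          (MvPolynomial.basisMonomials (Option (hatNonmin P)) k).repr.toLinearMap := by
      refine (MvPolynomial.basisMonomials (Option (hatNonmin P)) k).ext fun m => ?_
      rw [LinearMap.comp_apply, LinearEquiv.coe_coe, Module.Basis.repr_self,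
        Finsupp.linearCombination_single, one_smul, MvPolynomial.coe_basisMonomials,
        AlgHom.toLinearMap_apply, MvPolynomial.aeval_monomial, map_one, one_mul,
        Finsupp.prod_fintype _ _ fun _ => pow_zero _]
      simp only [y, gradedMonomial_pow]
      rw [prod_gradedMonomial]
    rw [algebraicIndependent_iff_injective_aeval]
    have h5 : Function.Injective (Finsupp.linearCombination k
        (fun m => gradedMonomial k (E m).2 (E m).1) ∘ₗ
          (MvPolynomial.basisMonomials (Option (hatNonmin P)) k).repr.toLinearMap) := by
      rw [LinearMap.coe_comp]
      exact Function.Injective.comp (g := Finsupp.linearCombination k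
        (fun m => gradedMonomial k (E m).2 (E m).1)) hli (LinearEquiv.injective _)
    rw [← haev] at h5
    exact h5
  have h1 := hy.lift_cardinalMk_le_trdeg
  rw [Cardinal.mk_fintype, Fintype.card_option, ← Nat.card_eq_fintype_card,
    Nat.card_coe_set_eq] at h1
  simpa using h1

theorem ringKrullDim_minAlgebra :
    ringKrullDim (minAlgebra k P) = ((hatNonmin P).ncard : WithBot ℕ∞) + 1 := by
  have h : Algebra.trdeg k (minAlgebra k P) = ((hatNonmin P).ncard + 1 : ℕ) :=
    le_antisymm trdeg_minAlgebra_le le_trdeg_minAlgebra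
  rw [ringKrullDim_eq_of_trdeg_eq k (minAlgebra k P) h, Nat.cast_succ]

end TranscendenceDegree

/-! ### The fiber over the irrelevant ideal -/

section Fiber

theorem ringKrullDim_tensor_quotient (R A : Type*) [CommRing R] [CommRing A] [Algebra R A]
    (I : Ideal R) :
    ringKrullDim (A ⊗[R] (R ⧸ I)) = ringKrullDim (A ⧸ I.map (algebraMap R A)) :=
  (ringKrullDim_eq_of_ringEquiv
    (Algebra.TensorProduct.quotIdealMapEquivTensorQuot A I).toRingEquiv).symm

variable {k P : Type*} [Field k] [PartialOrder P] [Fintype P]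

/-- A shortcut for instance search. -/
instance commRingAnticanonicalAlgebra : CommRing (anticanonicalAlgebra k P) :=
  Subalgebra.toCommRing (anticanonicalAlgebra k P)

/-- A shortcut for instance search. -/
instance algebraAnticanonicalAlgebra : Algebra (hibiRing k P) (anticanonicalAlgebra k P) :=
  Subalgebra.algebra (anticanonicalAlgebra k P)

theorem algebraMap_mem_of_mem_irrelevant {r : hibiRing k P} (hr : r ∈ irrelevant k P) :
    algebraMap (hibiRing k P) (Frac k P) r ∈
      laurentSpan k P (weights P (0 : ℕ) \ minWeights P 0) := by
  induction hr using Submodule.span_induction with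
  | mem r hr =>
    obtain ⟨I, hI⟩ := hr
    change algebraMap (Poly k P) (Frac k P) r ∈ _
    rw [hI, algebraMap_idealMonomial, laurentMonomial_mem_laurentSpan]
    refine ⟨by simpa using idealWeight_mem_weights_zero I, fun h => ?_⟩
    have := congrFun (mem_minWeights_zero_iff.1 h) ⊥
    simp at this
  | zero => rw [map_zero]; exact Submodule.zero_mem _
  | add x y _ _ hx hy => rw [map_add]; exact Submodule.add_mem _ hx hy
  | smul r x _ hx =>
    rw [smul_eq_mul, map_mul]
    refine mul_mem_laurentSpan (algebraMap_mem_laurentSpan r) hx fun ξ hξ ζ hζ => ?_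
    simpa using add_mem_weights_diff_minWeights (m := 0) (by simpa using hξ) hζ

theorem exists_mem_irrelevant {ξ : WithBot P → ℤ} (hξ : ξ ∈ weights P 0) (h0 : ξ ≠ 0) :
    ∃ r ∈ irrelevant k P,
      algebraMap (hibiRing k P) (Frac k P) r = laurentMonomial k P ξ := by
  have h1 : 1 ≤ ξ ⊥ := by
    by_contra h
    exact h0 (eq_zero_of_mem_weights_zero hξ (by omega))
  obtain ⟨I, hI⟩ := exists_sub_idealWeight_mem_weights_zero hξ h1
  obtain ⟨r, hr⟩ := exists_algebraMap_eq_laurentMonomial (k := k) hI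
  refine ⟨r * ⟨idealMonomial k P I, idealMonomial_mem k P I⟩,
    Ideal.mul_mem_left _ _ (Ideal.subset_span ⟨I, rfl⟩), ?_⟩
  rw [map_mul, hr]
  change _ * algebraMap (Poly k P) (Frac k P) (idealMonomial k P I) = _
  rw [algebraMap_idealMonomial, ← laurentMonomial_add, sub_add_cancel]

/-- The extension of the irrelevant ideal to `⨁ ω^(-n)` involves no monomial of least degree. -/
theorem coeff_mem_of_mem_map_irrelevant {f : anticanonicalAlgebra k P}
    (hf : f ∈ (irrelevant k P).map (algebraMap (hibiRing k P) (anticanonicalAlgebra k P))) (n : ℕ) :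
    (f : (Frac k P)[X]).coeff n ∈ laurentSpan k P (weights P n \ minWeights P n) := by
  induction hf using Submodule.span_induction generalizing n with
  | mem f hf =>
    obtain ⟨r, hr, rfl⟩ := hf
    change (algebraMap (hibiRing k P) (Frac k P)[X] r).coeff n ∈ _
    rw [Polynomial.algebraMap_apply, Polynomial.coeff_C]
    split_ifs with h
    · subst h
      exact algebraMap_mem_of_mem_irrelevant hr
    · exact Submodule.zero_mem _
  | zero => exact Submodule.zero_mem _
  | add x y _ _ hx hy =>
    rw [Subalgebra.coe_add, Polynomial.coeff_add]
    exact Submodule.add_mem _ (hx n) (hy n)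
  | smul g x _ hx =>
    rw [smul_eq_mul, Subalgebra.coe_mul, Polynomial.coeff_mul]
    refine Submodule.sum_mem _ ?_
    rintro ⟨i, j⟩ hij
    rw [← Finset.HasAntidiagonal.mem_antidiagonal.1 hij]
    exact mul_mem_laurentSpan (mem_omegaNeg_iff.1 (g.2 i)) (hx j) fun ξ hξ ζ hζ =>
      add_mem_weights_diff_minWeights hξ hζ

theorem minAlgebra_le_anticanonicalAlgebra {f : (Frac k P)[X]} (hf : f ∈ minAlgebra k P) :
    f ∈ anticanonicalAlgebra k P := fun n =>
  mem_omegaNeg_iff.2 (laurentSpan_mono (fun _ hξ => hξ.1) (hf n))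

/-- Modulo the irrelevant ideal, `⨁ ω^(-n)` is spanned by the monomials of least degree. -/
theorem exists_add_of_mem_anticanonicalAlgebra
    (hl : ∀ ξ ∈ weights P 1, ∃ μ ∈ minWeights P 1, ξ - μ ∈ weights P 0)
    {f : (Frac k P)[X]} (hf : f ∈ anticanonicalAlgebra k P) :
    ∃ b ∈ minAlgebra k P, ∃ g : anticanonicalAlgebra k P,
      g ∈ (irrelevant k P).map (algebraMap (hibiRing k P) (anticanonicalAlgebra k P)) ∧
      b + g = f := by
  set I := (irrelevant k P).map (algebraMap (hibiRing k P) (anticanonicalAlgebra k P)) with hI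
  let D : AddSubmonoid (Frac k P)[X] :=
    { carrier := {f | ∃ b ∈ minAlgebra k P, ∃ g : anticanonicalAlgebra k P, g ∈ I ∧ b + g = f}
      zero_mem' := ⟨0, zero_mem _, 0, zero_mem _, by simp⟩
      add_mem' := by
        rintro _ _ ⟨b, hb, g, hg, rfl⟩ ⟨b', hb', g', hg', rfl⟩
        refine ⟨b + b', add_mem hb hb', g + g', add_mem hg hg', ?_⟩
        rw [Subalgebra.coe_add]
        ring }
  change f ∈ D
  rw [f.as_sum_support]
  refine sum_mem fun n _ => ?_
  have h := mem_omegaNeg_iff.1 (hf n)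
  generalize f.coeff n = c at h
  induction h using Submodule.span_induction with
  | mem x hx =>
    obtain ⟨ξ, hξ, rfl⟩ := hx
    obtain ⟨μ, hμ, hμ'⟩ := exists_minWeights_of_mem_weights hl n ξ hξ
    have hb := gradedMonomial_mem_minAlgebra (k := k) hμ
    by_cases h0 : ξ - μ = 0
    · rw [sub_eq_zero.1 h0]
      exact ⟨_, hb, 0, zero_mem _, by simp [gradedMonomial]⟩
    · obtain ⟨r, hr, hrξ⟩ := exists_mem_irrelevant (k := k) hμ' h0
      refine ⟨0, zero_mem _, algebraMap (hibiRing k P) (anticanonicalAlgebra k P) r *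
        ⟨_, minAlgebra_le_anticanonicalAlgebra hb⟩,
        Ideal.mul_mem_right _ _ (Ideal.mem_map_of_mem _ hr), ?_⟩
      rw [zero_add, Subalgebra.coe_mul]
      change algebraMap (hibiRing k P) (Frac k P)[X] r * gradedMonomial k n μ = _
      rw [Polynomial.algebraMap_apply, hrξ, gradedMonomial, Polynomial.C_mul_monomial,
        ← laurentMonomial_add, sub_add_cancel]
  | zero => rw [map_zero]; exact zero_mem _
  | add x y _ _ hx hy => rw [map_add]; exact add_mem hx hy
  | smul c x _ hx =>
    obtain ⟨b, hb, g, hg, h⟩ := hx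
    refine ⟨c • b, Subalgebra.smul_mem _ hb c, algebraMap (hibiRing k P) _ (c • 1) * g,
      Ideal.mul_mem_left _ _ hg, ?_⟩
    rw [← Polynomial.smul_monomial, ← h, smul_add, Subalgebra.coe_mul]
    congr 1
    change algebraMap (hibiRing k P) (Frac k P)[X] (c • 1) * (g : (Frac k P)[X]) = _
    rw [Polynomial.algebraMap_apply, smul_eq_algebraMap_mul, map_one, ← Polynomial.smul_C,
      smul_mul_assoc, Polynomial.C_1, one_mul]

variable (k P) in
/-- The map from `minAlgebra` to the fiber of `⨁ ω^(-n)` over the irrelevant ideal. -/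
def minAlgebraToFiber : minAlgebra k P →+* anticanonicalAlgebra k P ⧸
    (irrelevant k P).map (algebraMap (hibiRing k P) (anticanonicalAlgebra k P)) :=
  (Ideal.Quotient.mk _).comp ((minAlgebra k P).val.toRingHom.codRestrict (anticanonicalAlgebra k P)
    fun f => minAlgebra_le_anticanonicalAlgebra f.2)

theorem bijective_minAlgebraToFiber
    (hl : ∀ ξ ∈ weights P 1, ∃ μ ∈ minWeights P 1, ξ - μ ∈ weights P 0) :
    Function.Bijective (minAlgebraToFiber k P) := by
  constructor
  · rw [injective_iff_map_eq_zero]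
    intro f hf
    have hf' : (⟨f, minAlgebra_le_anticanonicalAlgebra f.2⟩ : anticanonicalAlgebra k P) ∈
        (irrelevant k P).map (algebraMap (hibiRing k P) (anticanonicalAlgebra k P)) :=
      Ideal.Quotient.eq_zero_iff_mem.1 hf
    have h := coeff_mem_of_mem_map_irrelevant hf'
    ext n
    exact Submodule.disjoint_def.1 (disjoint_laurentSpan_minWeights n) _ (f.2 n) (h n)
  · intro x
    obtain ⟨f, rfl⟩ := Ideal.Quotient.mk_surjective x
    obtain ⟨b, hb, g, hg, h⟩ := exists_add_of_mem_anticanonicalAlgebra hl f.2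
    refine ⟨⟨b, hb⟩, (Ideal.Quotient.eq.2 ?_).symm⟩
    convert! hg using 1
    ext1
    rw [Subalgebra.coe_sub, ← h]
    exact add_sub_cancel_left _ _

theorem symbolicSpread_eq
    (hl : ∀ ξ ∈ weights P 1, ∃ μ ∈ minWeights P 1, ξ - μ ∈ weights P 0) :
    symbolicSpread k P = ((hatNonmin P).ncard : WithBot ℕ∞) + 1 := by
  have h := ringKrullDim_eq_of_ringEquiv
    (RingEquiv.ofBijective (minAlgebraToFiber k P) (bijective_minAlgebraToFiber hl))
  rw [← ringKrullDim_minAlgebra (k := k), h]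
  exact ringKrullDim_tensor_quotient (hibiRing k P) (anticanonicalAlgebra k P) (irrelevant k P)

end Fiber

end

end HibiRing

theorem theorem4 (k P : Type*) [Field k] [PartialOrder P] [Fintype P]
    (hlevel : HibiRing.IsAnticanonicalLevel k P) :
    (HibiRing.anticanonicalAlgebra k P).FG ∧
    ((fun n : ℕ => ((HibiRing.omegaNeg k P n).spanFinrank : ℝ)) =Θ[atTop]
      fun n : ℕ => (n : ℝ) ^ (HibiRing.hatNonmin P).ncard) ∧
    HibiRing.symbolicSpread k P = ((HibiRing.hatNonmin P).ncard : WithBot ℕ∞) + 1 := by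
  have hl := HibiRing.exists_minWeights_of_isAnticanonicalLevel hlevel
  refine ⟨HibiRing.anticanonicalAlgebra_fg hl, ?_, HibiRing.symbolicSpread_eq hl⟩
  simp only [HibiRing.spanFinrank_omegaNeg hl]
  exact HibiRing.ncard_minWeights_isTheta
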